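/- A seller offers $m$ items to one additive buyer. The buyer's values $t_1,\dots,t_m\ge 0$ are independent, $t_j\sim\mathcal D_j$, where the $\mathcal D_j$ are arbitrary probability distributions; put $\mathcal D=\mathcal D_1\times\dots\times\mathcal D_m$, let $T_j$ be the support of $\mathcal D_j$ and $T=T_1\times\dots\times T_m$. The seller's private cost vector $c=(c_1,\dots,c_m)$ with $c_j\ge 0$ is drawn, independently of $t$, from an arbitrary (possibly correlated) probability distribution $\mathcal C$. The distributions are known to both parties. A direct mechanism consists of allocation probabilities $x(t,c)\in[0,1]^m$ and payments $p(t,c)\in\mathbb R$. It is Bayesian incentive compatible (BIC) if $\mathbb E_c[t\cdot x(t,c)-p(t,c)]\ge \mathbb E_c[t\cdot x(t',c)-p(t',c)]$ for all $t,t'\in T$, and interim individually rational (IR) if $\mathbb E_c[t\cdot x(t,c)-p(t,c)]\ge 0$ for all $t\in T$. Its profit is $\mathbb E_{t,c}[p(t,c)-c\cdot x(t,c)]$. Let $\mathrm{OPT}\in[0,\infty]$ be the supremum of the profits of all direct, BIC and interim IR mechanisms (for which these expectations exist). Define three quantities in $[0,\infty]$. * $\mathrm{IP}$ (item posted pricing):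 the supremum of the expected profit over all price functions $p_j(c)$, where for each realized $c$ the buyer takes her favorite bundle of items at the prices $p_j(c)$. * $\mathrm{PP}$ (permit posted pricing): the supremum of the expected profit over all permit prices $\ell_1,\dots,\ell_m$ that do not depend on $c$. Without knowing $c$, the buyer first buys a set $P$ of permits that maximizes $\mathbb E_c\big[\max_{S\subseteq P}\sum_{j\in S}(t_j-c_j)\big]-\sum_{j\in P}\ell_j$. Then $c$ is revealed and she buys her favorite bundle among the items in $P$, item $j$ being sold at the price $c_j$. * $\mathrm{PB}$ (permit bundling): the same, except that the permits are sold only as one grand bundle of all $m$ permits, at a price $\delta$ that does not depend on $c$ and which the buyer may decline; the supremum is over $\delta$. Then, for all such $\mathcal D$ and $\mathcal C$, $$\mathrm{OPT}\le \mathrm{IP}+3\,\mathrm{PP}+2\,\mathrm{PB}.$$ In particular the best of the three classes of mechanisms is a $6$-approximation to the optimal profit: $\mathrm{OPT}\le 6\max\{\mathrm{IP},\mathrm{PP},\mathrm{PB}\}$. -/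

import Mathlib

open MeasureTheory

noncomputable section

namespace ProfitMax

/-- The distribution of the buyer's type: her values for the `m` items are independent, the value
for item `j` having law `D j`. -/
def typeLaw {m : ℕ} (D : Fin m → Measure ℝ) : Measure (Fin m → ℝ) := Measure.pi D

/-- The type space `T = T₁ × ⋯ × Tₘ`, where `T j` is the support of `D j`. -/
def typeSpace {m : ℕ} (D : Fin m → Measure ℝ) : Set (Fin m → ℝ) :=
  {t | ∀ j, t j ∈ (D j).support}

/-! ### Direct mechanisms and the optimal profit -/

/-- A direct mechanism for one additive buyer. When the buyer reports the type `t` and the seller's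
cost vector is `c`, the buyer receives item `j` with probability `alloc t c j` and pays `pay t c`
(a negative payment is a transfer to the buyer). -/
structure DirectMechanism (m : ℕ) where
  alloc : (Fin m → ℝ) → (Fin m → ℝ) → Fin m → ℝ
  pay : (Fin m → ℝ) → (Fin m → ℝ) → ℝ
  alloc_nonneg : ∀ t c j, 0 ≤ alloc t c j
  alloc_le_one : ∀ t c j, alloc t c j ≤ 1
  measurable_alloc : Measurable fun z : (Fin m → ℝ) × (Fin m → ℝ) => alloc z.1 z.2
  measurable_pay : Measurable fun z : (Fin m → ℝ) × (Fin m → ℝ) => pay z.1 z.2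

namespace DirectMechanism

variable {m : ℕ} (M : DirectMechanism m)

/-- The utility, expected over the seller's costs, of a buyer of type `t` who reports `r`. -/
def interimUtility (C : Measure (Fin m → ℝ)) (t r : Fin m → ℝ) : ℝ :=
  ∫ c, ((∑ j, t j * M.alloc r c j) - M.pay r c) ∂C

/-- Bayesian incentive compatibility. -/
def IsBIC (D : Fin m → Measure ℝ) (C : Measure (Fin m → ℝ)) : Prop :=
  ∀ t ∈ typeSpace D, ∀ r ∈ typeSpace D, M.interimUtility C t r ≤ M.interimUtility C t t

/-- Interim individual rationality. -/
def IsInterimIR (D : Fin m → Measure ℝ) (C : Measure (Fin m → ℝ)) : Prop :=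
  ∀ t ∈ typeSpace D, 0 ≤ M.interimUtility C t t

/-- The seller's profit: the payment minus the expected cost of the items given away. -/
def profitAt (t c : Fin m → ℝ) : ℝ := M.pay t c - ∑ j, c j * M.alloc t c j

/-- All the expectations that enter the utilities and the profit exist. -/
def HasExpectations (D : Fin m → Measure ℝ) (C : Measure (Fin m → ℝ)) : Prop :=
  (∀ t ∈ typeSpace D, Integrable (fun c => M.pay t c) C) ∧
    Integrable (fun z : (Fin m → ℝ) × (Fin m → ℝ) => M.profitAt z.1 z.2) ((typeLaw D).prod C)

/-- The seller's expected profit. -/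
def profit (D : Fin m → Measure ℝ) (C : Measure (Fin m → ℝ)) : ℝ :=
  ∫ z : (Fin m → ℝ) × (Fin m → ℝ), M.profitAt z.1 z.2 ∂((typeLaw D).prod C)

end DirectMechanism

/-- `OPT`: the supremum of the profits of the direct, BIC and interim IR mechanisms. -/
def optProfit {m : ℕ} (D : Fin m → Measure ℝ) (C : Measure (Fin m → ℝ)) : EReal :=
  ⨆ (M : DirectMechanism m)
    (_ : M.HasExpectations D C ∧ M.IsBIC D C ∧ M.IsInterimIR D C), (M.profit D C : EReal)

/-! ### The buyer's choices -/

/-- `S` is a favourite option in the menu `menu`, for the utility `u`. -/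
def IsFavorite {m : ℕ} (menu : Finset (Finset (Fin m))) (u : Finset (Fin m) → ℝ)
    (S : Finset (Fin m)) : Prop :=
  S ∈ menu ∧ ∀ S' ∈ menu, u S' ≤ u S

/-- The utility of an additive buyer of type `t` from buying the bundle `S` at item prices `q`. -/
def bundleUtility {m : ℕ} (t q : Fin m → ℝ) (S : Finset (Fin m)) : ℝ := ∑ j ∈ S, (t j - q j)

/-- The value of the set `P` of permits to a buyer of type `t`, before the costs are revealed:
`E_c [max_{S ⊆ P} ∑_{j ∈ S} (t j - c j)]`, since item `j` will be sold at its cost `c j`. -/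
def permitValue {m : ℕ} (C : Measure (Fin m → ℝ)) (t : Fin m → ℝ) (P : Finset (Fin m)) : ℝ :=
  ∫ c, P.powerset.sup' (Finset.powerset_nonempty P) (bundleUtility t c) ∂C

/-! ### Item posted pricing -/

/-- Item posted pricing: when the costs are `c`, item `j` is offered at the price `price c j`, and
the buyer takes a bundle that she likes best. -/
structure ItemPricing (m : ℕ) where
  price : (Fin m → ℝ) → Fin m → ℝ
  bundle : (Fin m → ℝ) → (Fin m → ℝ) → Finset (Fin m)
  bundle_favorite : ∀ t c, IsFavorite Finset.univ (bundleUtility t (price c)) (bundle t c)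
  measurable_price : Measurable price
  measurable_bundle :
    ∀ j, MeasurableSet {z : (Fin m → ℝ) × (Fin m → ℝ) | j ∈ bundle z.1 z.2}

/-- The profit of item posted pricing: prices minus costs of the items sold. -/
def ItemPricing.profitAt {m : ℕ} (M : ItemPricing m) (t c : Fin m → ℝ) : ℝ :=
  ∑ j ∈ M.bundle t c, (M.price c j - c j)

/-- `IP`: the supremum of the expected profits of item posted pricing. -/
def ipProfit {m : ℕ} (D : Fin m → Measure ℝ) (C : Measure (Fin m → ℝ)) : EReal :=
  ⨆ (M : ItemPricing m)
    (_ : Integrable (fun z : (Fin m → ℝ) × (Fin m → ℝ) => M.profitAt z.1 z.2)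
      ((typeLaw D).prod C)),
    ((∫ z : (Fin m → ℝ) × (Fin m → ℝ), M.profitAt z.1 z.2 ∂((typeLaw D).prod C) : ℝ) : EReal)

/-! ### Permit selling -/

/-- A permit-selling mechanism. In the first stage the buyer, who does not know the costs, picks a
set of permits `P ∈ menu` and pays `permitPrice P`. In the second stage the costs `c` are revealed,
and she may buy each item for which she holds a permit at the price `c j`. In both stages she makes
a choice that she likes best. -/
structure PermitSelling {m : ℕ} (C : Measure (Fin m → ℝ)) (menu : Finset (Finset (Fin m)))
    (permitPrice : Finset (Fin m) → ℝ) where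
  permits : (Fin m → ℝ) → Finset (Fin m)
  bundle : (Fin m → ℝ) → (Fin m → ℝ) → Finset (Fin m)
  permits_favorite :
    ∀ t, IsFavorite menu (fun P => permitValue C t P - permitPrice P) (permits t)
  bundle_favorite : ∀ t c, IsFavorite (permits t).powerset (bundleUtility t c) (bundle t c)
  measurable_permits : ∀ j, MeasurableSet {t | j ∈ permits t}
  measurable_bundle :
    ∀ j, MeasurableSet {z : (Fin m → ℝ) × (Fin m → ℝ) | j ∈ bundle z.1 z.2}

/-- The profit of permit selling: the price of the permits, plus the prices (here equal to the
costs) minus the costs of the items sold. -/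
def PermitSelling.profitAt {m : ℕ} {C : Measure (Fin m → ℝ)} {menu : Finset (Finset (Fin m))}
    {permitPrice : Finset (Fin m) → ℝ} (M : PermitSelling C menu permitPrice)
    (t c : Fin m → ℝ) : ℝ :=
  permitPrice (M.permits t) + ∑ j ∈ M.bundle t c, (c j - c j)

/-- The expected profit of permit selling. -/
def PermitSelling.profit {m : ℕ} {C : Measure (Fin m → ℝ)} {menu : Finset (Finset (Fin m))}
    {permitPrice : Finset (Fin m) → ℝ} (M : PermitSelling C menu permitPrice)
    (D : Fin m → Measure ℝ) : ℝ :=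
  ∫ z : (Fin m → ℝ) × (Fin m → ℝ), M.profitAt z.1 z.2 ∂((typeLaw D).prod C)

/-- `PP`: the supremum of the expected profits when the permits are sold separately, the permit for
item `j` at the price `l j`. -/
def ppProfit {m : ℕ} (D : Fin m → Measure ℝ) (C : Measure (Fin m → ℝ)) : EReal :=
  ⨆ (l : Fin m → ℝ) (M : PermitSelling C Finset.univ (fun P => ∑ j ∈ P, l j)),
    (M.profit D : EReal)

/-- `PB`: the supremum of the expected profits when all permits are sold as one bundle at the price
`δ`, which the buyer may decline. -/
def pbProfit {m : ℕ} (D : Fin m → Measure ℝ) (C : Measure (Fin m → ℝ)) : EReal :=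
  ⨆ (δ : ℝ) (M : PermitSelling C {∅, Finset.univ} (fun P => if P = ∅ then 0 else δ)),
    (M.profit D : EReal)

end ProfitMax

end

namespace ProfitMax

open Set Filter Topology ProbabilityTheory
open scoped ENNReal

/-! Write `v_j(s) = E_c max(s - c_j, 0)` for the value of the permit for item `j`. From a truthful
type `t` the expected profit is `∑_j (t_j X_j - K_j) - U`, with `X_j` the interim allocation, `K_j`
the expected cost incurred on item `j` and `U` the buyer's utility. Each summand is at most
`v_j(t_j)`. If `i` maximizes `v_j(t_j)` and the whole utility is charged to item `i`, the profit is
at most `t_i X_i - U - K_i` plus `∑_{j ≠ i} v_j(t_j)`.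

The first part costs one `IP` (`lintegral_itemSurplus_le`). With the other values fixed, BIC and IR
turn item `j` into a single-item mechanism. A type `s` pays at most `∫ τ(q) dq` over `0 < q < X(s)`,
where `τ(q)` is the lowest type served with probability at least `q`. Serving her costs at least `∫
κ(q) dq` over the same range, where `κ` is the quantile function of the cost. So at each level `q`
the mechanism does no better than the posted price `τ(q)` against the cost `κ(q)`, and for uniform
`q` the cost `κ(q)` has the law of `c_j`. The estimate holds for positive parts, so it can be summed
over all items without recording which one is `i`.

For the second part, second-stage prices equal costs, so selling permits is a costless sale to an
additive buyer with independent values `v_j(t_j)`. Split at `r = PP`. Values above `r` that another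
value matches or exceeds contribute at most `r` (`lintegral_tailValue_le`). Values up to `r` have a
sum of variance at most `2 r²`; by Chebyshev the grand bundle priced `2 r` below the mean of that
sum sells with probability at least `1/2`, so the mean is at most `2 r + 2 PB`
(`lintegral_coreValue_le`). Altogether `IP + PP + (2 PP + 2 PB)`. -/

/-! ### Quantiles of nonnegative random variables -/

/-- The quantile function of a probability measure on the nonnegative half-line. -/
noncomputable def quantile (μ : Measure ℝ) (q : ℝ) : ℝ := sInf {x | 0 ≤ x ∧ q ≤ cdf μ x}

lemma quantile_nonneg (μ : Measure ℝ) (q : ℝ) : 0 ≤ quantile μ q :=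
  Real.sInf_nonneg fun _ hx => hx.1

/-- Right continuity of the cdf makes the infimum attained. The condition `q < 1` keeps the set
nonempty, and `0 ≤ x` is needed because the infimum runs over nonnegative reals only. -/
lemma quantile_le_iff (μ : Measure ℝ) {q x : ℝ} (hq : q < 1) (hx : 0 ≤ x) :
    quantile μ q ≤ x ↔ q ≤ cdf μ x := by
  have hbdd : BddBelow {x | 0 ≤ x ∧ q ≤ cdf μ x} := ⟨0, fun _ h => h.1⟩
  have hne : {x | 0 ≤ x ∧ q ≤ cdf μ x}.Nonempty := by
    obtain ⟨y, h1, h2⟩ := (((tendsto_cdf_atTop μ).eventually (eventually_ge_nhds hq)).and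
      (eventually_ge_atTop 0)).exists
    exact ⟨y, h2, h1⟩
  refine ⟨fun h => ?_, fun h => csInf_le hbdd ⟨hx, h⟩⟩
  have hr : Tendsto (cdf μ) (𝓝[>] x) (𝓝 (cdf μ x)) :=
    (((cdf μ).right_continuous x).mono Ioi_subset_Ici_self).tendsto
  refine ge_of_tendsto hr ?_
  filter_upwards [self_mem_nhdsWithin] with y hy
  obtain ⟨z, hz, hzy⟩ := (csInf_lt_iff hbdd hne).1 (lt_of_le_of_lt h hy)
  exact hz.2.trans (monotone_cdf μ hzy.le)

lemma monotoneOn_quantile (μ : Measure ℝ) : MonotoneOn (quantile μ) (Iio 1) := by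
  intro p hp q hq hpq
  rw [quantile_le_iff μ hp (quantile_nonneg μ q)]
  exact hpq.trans ((quantile_le_iff μ hq (quantile_nonneg μ q)).1 le_rfl)

lemma aemeasurable_quantile (μ : Measure ℝ) :
    AEMeasurable (quantile μ) (volume.restrict (Ioo 0 1)) :=
  aemeasurable_restrict_of_monotoneOn measurableSet_Ioo
    ((monotoneOn_quantile μ).mono fun _ h => h.2)

/-- Inverse transform sampling: a uniform `q` yields a sample of `μ`. -/
lemma map_quantile (μ : Measure ℝ) [IsProbabilityMeasure μ] (hμ : ∀ᵐ x ∂μ, 0 ≤ x) :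
    (volume.restrict (Ioo (0 : ℝ) 1)).map (quantile μ) = μ := by
  have : IsFiniteMeasure ((volume.restrict (Ioo (0 : ℝ) 1)).map (quantile μ)) :=
    inferInstance
  refine Measure.ext_of_Iic _ _ fun x => ?_
  rw [Measure.map_apply_of_aemeasurable (aemeasurable_quantile μ) measurableSet_Iic,
    Measure.restrict_apply' measurableSet_Ioo]
  rcases lt_or_ge x 0 with hx | hx
  · have h1 : quantile μ ⁻¹' Iic x ∩ Ioo 0 1 = ∅ := by
      ext q
      simp only [mem_inter_iff, mem_preimage, mem_Iic, mem_Ioo, mem_empty_iff_false, iff_false]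
      intro h
      linarith [quantile_nonneg μ q, h.1]
    rw [h1, measure_empty]
    refine (measure_mono_null (t := {y | ¬ 0 ≤ y}) (fun y hy => ?_) (ae_iff.1 hμ)).symm
    simp only [mem_Iic, mem_ofPred_eq, not_le] at hy ⊢
    linarith
  · rw [← ofReal_cdf]
    refine le_antisymm ?_ ?_
    · calc _ ≤ volume (Ioc 0 (cdf μ x)) := by
            refine measure_mono fun q hq => ⟨hq.2.1, ?_⟩
            exact (quantile_le_iff μ hq.2.2 hx).1 hq.1
        _ = _ := by simp
    · calc _ = volume (Ioo 0 (cdf μ x)) := by simp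
        _ ≤ _ := by
            refine measure_mono fun q hq => ?_
            have hq1 : q < 1 := hq.2.trans_le (cdf_le_one μ x)
            exact ⟨(quantile_le_iff μ hq1 hx).2 hq.2.le, hq.1, hq1⟩

/-- Serving the lowest costs first is cheapest: among all the ways of allocating with a given total
probability, the cost is at least the integral of the quantile function of the cost. -/
lemma lintegral_quantile_le {Ω : Type*} [MeasurableSpace Ω] (P : Measure Ω)
    [IsProbabilityMeasure P] {f x : Ω → ℝ} (hf : Measurable f) (hf0 : ∀ᵐ ω ∂P, 0 ≤ f ω)
    (hx : Measurable x) (hx0 : ∀ ω, 0 ≤ x ω) (hx1 : ∀ ω, x ω ≤ 1) :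
    ∫⁻ q in Ioo 0 (∫ ω, x ω ∂P), ENNReal.ofReal (quantile (P.map f) q)
      ≤ ∫⁻ ω, ENNReal.ofReal (f ω * x ω) ∂P := by
  set X := ∫ ω, x ω ∂P with hX
  have : IsProbabilityMeasure (P.map f) := Measure.isProbabilityMeasure_map hf.aemeasurable
  have hint : Integrable x P := Integrable.of_bound hx.aestronglyMeasurable 1
    (Eventually.of_forall fun ω => by rw [Real.norm_eq_abs, abs_of_nonneg (hx0 ω)]; exact hx1 ω)
  have hX1 : X ≤ 1 := by
    calc X ≤ ∫ ω, (1 : ℝ) ∂P := integral_mono hint (integrable_const _) hx1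
      _ = 1 := by simp
  have hsub : Ioo 0 X ⊆ Ioo 0 1 := Ioo_subset_Ioo_right hX1
  have hXl : ∫⁻ ω, ENNReal.ofReal (x ω) ∂P = ENNReal.ofReal X :=
    (ofReal_integral_eq_lintegral_ofReal hint (Eventually.of_forall hx0)).symm
  set ν := P.withDensity fun ω => ENNReal.ofReal (x ω) with hν
  have hR : ∫⁻ ω, ENNReal.ofReal (f ω * x ω) ∂P = ∫⁻ ω, ENNReal.ofReal (f ω) ∂ν := by
    rw [hν, lintegral_withDensity_eq_lintegral_mul _ hx.ennreal_ofReal hf.ennreal_ofReal]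
    refine lintegral_congr fun ω => ?_
    rw [mul_comm, ENNReal.ofReal_mul (hx0 ω)]
    rfl
  have hνac : ν ≪ P := withDensity_absolutelyContinuous _ _
  -- Layer cake on both sides, then comparison at each cost level `κ`. As `x ≤ 1`, at most `P {f ≤
  -- κ}` of the total allocation `X` can go to costs up to `κ`; the rest is served above `κ`.
  rw [hR, lintegral_eq_lintegral_meas_lt ν (hνac.ae_le hf0) hf.aemeasurable,
    lintegral_eq_lintegral_meas_lt _ (Eventually.of_forall fun q => quantile_nonneg _ q)
      ((aemeasurable_quantile _).mono_measure (Measure.restrict_mono hsub le_rfl))]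
  refine setLIntegral_mono' measurableSet_Ioi fun κ hκ => ?_
  have hκ0 : (0 : ℝ) ≤ κ := (mem_Ioi.1 hκ).le
  calc (volume.restrict (Ioo 0 X)) {q | κ < quantile (P.map f) q}
      ≤ volume (Ioo (cdf (P.map f) κ) X) := by
        rw [Measure.restrict_apply' measurableSet_Ioo]
        refine measure_mono fun q hq => ⟨?_, hq.2.2⟩
        have := (quantile_le_iff (P.map f) (hq.2.2.trans_le hX1) hκ0).not.1 (not_le.2 hq.1)
        exact not_le.1 this
    _ = ENNReal.ofReal X - P {ω | f ω ≤ κ} := by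
        rw [Real.volume_Ioo, ENNReal.ofReal_sub _ (cdf_nonneg _ _), ofReal_cdf,
          Measure.map_apply hf measurableSet_Iic]
        rfl
    _ ≤ ν {ω | κ < f ω} := by
        rw [tsub_le_iff_right, ← hXl]
        have hle : MeasurableSet {ω | f ω ≤ κ} := hf measurableSet_Iic
        have hlt : MeasurableSet {ω | κ < f ω} := hf measurableSet_Ioi
        calc ∫⁻ ω, ENNReal.ofReal (x ω) ∂P
            = ν {ω | κ < f ω} + ν {ω | κ < f ω}ᶜ := by
              rw [measure_add_measure_compl hlt, hν, withDensity_apply _ MeasurableSet.univ,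
                setLIntegral_univ]
          _ ≤ _ := by
              refine add_le_add_right ?_ _
              have hc : {ω | κ < f ω}ᶜ = {ω | f ω ≤ κ} := by ext; simp
              rw [hc, hν, withDensity_apply _ hle]
              calc _ ≤ ∫⁻ ω in {ω | f ω ≤ κ}, 1 ∂P := by
                    refine lintegral_mono fun ω => ?_
                    simpa using hx1 ω
                _ = _ := by simp

/-! ### Single-item mechanisms as mixtures of posted prices -/

/-- A function whose increments are bounded by a monotone function at the right end point is
bounded by the integral of that function. -/
lemma sub_le_intervalIntegral_of_monotoneOn {f τ : ℝ → ℝ} {b : ℝ} (hb : 0 ≤ b)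
    (hτ : MonotoneOn τ (Icc 0 b))
    (h : ∀ p q, 0 ≤ p → p ≤ q → q ≤ b → f q - f p ≤ (q - p) * τ q) :
    f b - f 0 ≤ ∫ q in (0 : ℝ)..b, τ q := by
  -- Right Riemann sums over `n + 1` equal cells bound the increment of `f`. They exceed the left
  -- sums, hence the integral, by at most `b (τ b - τ 0) / (n + 1)`.
  have key : ∀ n : ℕ, f b - f 0 ≤ (∫ q in (0 : ℝ)..b, τ q) + (b * (τ b - τ 0)) / ((n : ℝ) + 1) := by
    intro n
    set N : ℕ := n + 1 with hN
    have hNr : (n : ℝ) + 1 = N := by simp [hN]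
    have hN0 : (0 : ℝ) < N := by rw [← hNr]; positivity
    rw [hNr]
    set d : ℝ := b / N with hd
    have hd0 : 0 ≤ d := by positivity
    have hNd : (N : ℝ) * d = b := by rw [hd]; field_simp
    have hmem : ∀ x : ℝ, 0 ≤ x → x ≤ N → x * d ∈ Icc 0 b := fun x h0 h1 =>
      ⟨by positivity, by rw [← hNd]; gcongr⟩
    have hmono : MonotoneOn (fun x => τ (x * d)) (Icc (0 : ℝ) (0 + N)) := by
      intro x hx y hy hxy
      rw [zero_add] at hx hy
      exact hτ (hmem x hx.1 hx.2) (hmem y hy.1 hy.2) (by gcongr)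
    have h1 := hmono.sum_le_integral
    simp only [zero_add] at h1
    have h2 : d * ∫ x in (0 : ℝ)..N, τ (x * d) = ∫ q in (0 : ℝ)..b, τ q := by
      simp [hNd]
    have h3 : f b - f 0 = ∑ i ∈ Finset.range N, (f ((i + 1 : ℕ) * d) - f ((i : ℕ) * d)) := by
      rw [Finset.sum_range_sub (fun i : ℕ => f (i * d))]
      simp [hNd]
    have h4 : ∀ i ∈ Finset.range N,
        f ((i + 1 : ℕ) * d) - f ((i : ℕ) * d) ≤ d * τ ((i + 1 : ℕ) * d) := by
      intro i hi
      have hi' : i + 1 ≤ N := Finset.mem_range.1 hi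
      have hi'' : ((i + 1 : ℕ) : ℝ) ≤ N := by exact_mod_cast hi'
      have := h (i * d) ((i + 1 : ℕ) * d) (by positivity) (by gcongr; simp)
        (by rw [← hNd]; gcongr)
      refine this.trans (le_of_eq ?_)
      push_cast; ring
    have h5 : ∑ i ∈ Finset.range N, τ ((i + 1 : ℕ) * d)
        = ∑ i ∈ Finset.range N, τ ((i : ℕ) * d) + (τ b - τ 0) := by
      have := Finset.sum_range_sub (fun i : ℕ => τ (i * d)) N
      rw [Finset.sum_sub_distrib] at this
      simp only [hNd, Nat.cast_zero, zero_mul] at this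
      linarith
    have h6 := Finset.sum_le_sum h4
    rw [← h3, ← Finset.mul_sum, h5, mul_add] at h6
    have h7 := mul_le_mul_of_nonneg_left h1 hd0
    rw [h2] at h7
    have h8 : d * (τ b - τ 0) = b * (τ b - τ 0) / N := by rw [hd]; ring
    linarith
  have hlim : Tendsto (fun n : ℕ => (∫ q in (0 : ℝ)..b, τ q) + (b * (τ b - τ 0)) / ((n : ℝ) + 1))
      atTop (𝓝 ((∫ q in (0 : ℝ)..b, τ q) + 0)) := by
    refine tendsto_const_nhds.add ?_
    have := (tendsto_const_div_atTop_nhds_zero_nat (b * (τ b - τ 0))).comp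
      (tendsto_add_atTop_nat 1)
    simpa [Function.comp_def] using this
  simpa using ge_of_tendsto' hlim key

/-- The lowest type in `T` that is served with probability at least `q`. -/
noncomputable def lowestServed (T : Set ℝ) (X : ℝ → ℝ) (q : ℝ) : ℝ≥0∞ :=
  ⨅ r ∈ {r | r ∈ T ∧ q ≤ X r}, ENNReal.ofReal r

lemma monotone_lowestServed (T : Set ℝ) (X : ℝ → ℝ) : Monotone (lowestServed T X) :=
  fun _ _ hpq => biInf_mono fun _ hr => ⟨hr.1, hpq.trans hr.2⟩

lemma lowestServed_le {T : Set ℝ} {X : ℝ → ℝ} {q s : ℝ} (hs : s ∈ T) (hq : q ≤ X s) :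
    lowestServed T X q ≤ ENNReal.ofReal s :=
  iInf₂_le (f := fun r _ => ENNReal.ofReal r) s (show s ∈ {r | r ∈ T ∧ q ≤ X r} from ⟨hs, hq⟩)

/-- In a single-item mechanism that is incentive compatible and individually rational, a type pays
at most what the mixture of posted prices with the same allocation would charge her. -/
lemma ofReal_payment_le_lintegral {T : Set ℝ} (hT : ∀ s ∈ T, 0 ≤ s) {X u : ℝ → ℝ}
    (hX0 : ∀ s ∈ T, 0 ≤ X s) (hu : ∀ s ∈ T, 0 ≤ u s)
    (hIC : ∀ s ∈ T, ∀ r ∈ T, u r + (s - r) * X r ≤ u s) {s : ℝ} (hs : s ∈ T) :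
    ENNReal.ofReal (s * X s - u s) ≤ ∫⁻ q in Ioo 0 (X s), lowestServed T X q := by
  set b := X s with hb
  -- The convex conjugate of `u` over `T`. It is at least the payment at `q = X s`, at most `0` at
  -- `q = 0` by individual rationality, and its slopes up to `q` are bounded by every type served
  -- with probability at least `q`. No envelope formula is needed, so `T` may have gaps.
  set f : ℝ → ℝ := fun q => sSup ((fun r => q * r - u r) '' T) with hf
  have hbd : ∀ q ≤ b, BddAbove ((fun r => q * r - u r) '' T) := by
    intro q hq
    refine ⟨s * b - u s, ?_⟩
    rintro _ ⟨r, hr, rfl⟩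
    have h1 := hIC r hr s hs
    have h2 := mul_le_mul_of_nonneg_right hq (hT r hr)
    simp only
    nlinarith
  have hne : ∀ q, ((fun r => q * r - u r) '' T).Nonempty := fun q => ⟨_, s, hs, rfl⟩
  have hlt : ∀ q ≤ b, lowestServed T X q < ⊤ := fun q hq =>
    (lowestServed_le hs hq).trans_lt ENNReal.ofReal_lt_top
  have hτ : MonotoneOn (fun q => (lowestServed T X q).toReal) (Icc 0 b) :=
    fun p _ q hq hpq => ENNReal.toReal_mono (hlt q hq.2).ne (monotone_lowestServed T X hpq)
  have hstep : ∀ p q, 0 ≤ p → p ≤ q → q ≤ b →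
      f q - f p ≤ (q - p) * (lowestServed T X q).toReal := by
    intro p q hp hpq hq
    rcases hpq.eq_or_lt with rfl | hpq'
    · simp
    have hd : 0 < q - p := sub_pos.2 hpq'
    have hr : ∀ r ∈ T, q ≤ X r → (f q - f p) / (q - p) ≤ r := by
      intro r hr hqr
      rw [div_le_iff₀ hd, sub_le_iff_le_add]
      have hmem : p * r - u r ≤ f p := le_csSup (hbd p (hpq.trans hq)) ⟨r, hr, rfl⟩
      refine csSup_le (hne q) ?_
      rintro _ ⟨ρ, hρ, rfl⟩
      simp only
      -- A type `ρ ≤ r` has slope at most `r`. For `ρ ≥ r`, incentive compatibility and `q ≤ X r`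
      -- show that `r` does at least as well as `ρ` in the supremum at `q`.
      rcases le_total ρ r with h | h
      · have h1 : p * ρ - u ρ ≤ f p := le_csSup (hbd p (hpq.trans hq)) ⟨ρ, hρ, rfl⟩
        nlinarith
      · have h1 := hIC ρ hρ r hr
        have h2 := mul_le_mul_of_nonneg_left hqr (sub_nonneg.2 h)
        nlinarith
    have h1 : ENNReal.ofReal ((f q - f p) / (q - p)) ≤ lowestServed T X q :=
      le_iInf₂ fun r h => ENNReal.ofReal_le_ofReal (hr r h.1 h.2)
    rw [ENNReal.ofReal_le_iff_le_toReal (hlt q hq).ne, div_le_iff₀ hd] at h1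
    linarith
  have hb0 : 0 ≤ b := hX0 s hs
  have hmain := sub_le_intervalIntegral_of_monotoneOn hb0 hτ hstep
  have hf0 : f 0 ≤ 0 := by
    refine csSup_le (hne 0) ?_
    rintro _ ⟨r, hr, rfl⟩
    simpa using hu r hr
  have hfb : s * b - u s ≤ f b := by
    have : b * s - u s ≤ f b := le_csSup (hbd b le_rfl) ⟨s, hs, rfl⟩
    linarith [mul_comm b s]
  have hint : IntervalIntegrable (fun q => (lowestServed T X q).toReal) volume 0 b :=
    MonotoneOn.intervalIntegrable (by rwa [uIcc_of_le hb0])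
  calc ENNReal.ofReal (s * b - u s)
      ≤ ENNReal.ofReal (∫ q in (0 : ℝ)..b, (lowestServed T X q).toReal) :=
        ENNReal.ofReal_le_ofReal (by linarith)
    _ = ∫⁻ q in Ioc 0 b, ENNReal.ofReal (lowestServed T X q).toReal := by
        rw [intervalIntegral.integral_of_le hb0, ofReal_integral_eq_lintegral_ofReal]
        · exact (intervalIntegrable_iff_integrableOn_Ioc_of_le hb0).1 hint
        · exact Eventually.of_forall fun _ => ENNReal.toReal_nonneg
    _ ≤ ∫⁻ q in Ioc 0 b, lowestServed T X q :=
        lintegral_mono fun q => ENNReal.ofReal_toReal_le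
    _ = _ := by rw [restrict_Ioo_eq_restrict_Ioc]

/-- The optimal profit from posting a price for an item with value distribution `μ` and cost
`κ`. -/
noncomputable def itemProfit (μ : Measure ℝ) (κ : ℝ) : ℝ≥0∞ :=
  ⨆ p : ℚ, ENNReal.ofReal (p - κ) * μ (Ici (p : ℝ))

lemma measurable_itemProfit (μ : Measure ℝ) : Measurable (itemProfit μ) :=
  Measurable.iSup fun _ =>
    ((measurable_const.sub measurable_id).ennreal_ofReal).mul measurable_const

/-- Rational prices approach `p` from below, and lowering a price loses no sale. -/
lemma ofReal_mul_le_itemProfit (μ : Measure ℝ) [IsFiniteMeasure μ] (p κ : ℝ) :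
    ENNReal.ofReal (p - κ) * μ (Ici p) ≤ itemProfit μ κ := by
  obtain ⟨a, -, ha, hlim⟩ := Real.exists_seq_rat_strictMono_tendsto p
  have h1 : Tendsto (fun n => ENNReal.ofReal ((a n : ℝ) - κ) * μ (Ici p)) atTop
      (𝓝 (ENNReal.ofReal (p - κ) * μ (Ici p))) :=
    ENNReal.Tendsto.mul_const (ENNReal.tendsto_ofReal (hlim.sub_const κ))
      (Or.inr (measure_ne_top _ _))
  refine le_of_tendsto' h1 fun n => ?_
  refine le_trans ?_ (le_iSup (fun p : ℚ => ENNReal.ofReal (p - κ) * μ (Ici (p : ℝ))) (a n))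
  exact mul_le_mul' le_rfl (measure_mono (Ici_subset_Ici.2 (ha n).le))

/-- Every type served with probability above `q` accepts the posted price `lowestServed T X q`. -/
lemma lowestServed_mul_le_itemProfit (μ : Measure ℝ) [IsFiniteMeasure μ] {T : Set ℝ}
    (X : ℝ → ℝ) {κ : ℝ} (hκ : 0 ≤ κ) (q : ℝ) :
    (lowestServed T X q - ENNReal.ofReal κ) * μ {s | s ∈ T ∧ q < X s} ≤ itemProfit μ κ := by
  by_cases hne : ∃ s ∈ T, q < X s
  · obtain ⟨s, hs, hqs⟩ := hne
    have hlt : lowestServed T X q ≠ ⊤ :=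
      ((lowestServed_le hs hqs.le).trans_lt ENNReal.ofReal_lt_top).ne
    rw [← ENNReal.ofReal_toReal hlt, ← ENNReal.ofReal_sub _ hκ]
    -- At value `0` the clamping by `ENNReal.ofReal` could hide negative members of `T`, but then
    -- the left side vanishes.
    by_cases hp : lowestServed T X q = 0
    · rw [hp, ENNReal.toReal_zero, zero_sub, ENNReal.ofReal_of_nonpos (neg_nonpos.2 hκ), zero_mul]
      exact zero_le
    refine le_trans (mul_le_mul' le_rfl (measure_mono ?_))
      (ofReal_mul_le_itemProfit μ (lowestServed T X q).toReal κ)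
    rintro r ⟨hr, hqr⟩
    have h := lowestServed_le hr hqr.le
    rcases le_or_gt 0 r with h0 | h0
    · exact ENNReal.toReal_le_of_le_ofReal h0 h
    · rw [ENNReal.ofReal_of_nonpos h0.le] at h
      exact absurd (le_antisymm h bot_le) hp
  · have : {s | s ∈ T ∧ q < X s} = ∅ := by
      ext s
      simp only [mem_ofPred_eq, mem_empty_iff_false, iff_false]
      exact fun h => hne ⟨s, h.1, h.2⟩
    rw [this]
    simp

/-- The profit of a single-item mechanism that is incentive compatible and individually rational is
at most the profit from posting, for each cost, an optimal price. -/
lemma lintegral_ofReal_profit_le (μ γ : Measure ℝ) [IsProbabilityMeasure μ]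
    [IsProbabilityMeasure γ] (hγ : ∀ᵐ κ ∂γ, 0 ≤ κ) {T : Set ℝ} (hT : ∀ s ∈ T, 0 ≤ s)
    {X u K : ℝ → ℝ} (hX : Measurable X) (hX0 : ∀ s ∈ T, 0 ≤ X s) (hX1 : ∀ s ∈ T, X s ≤ 1)
    (hu : ∀ s ∈ T, 0 ≤ u s) (hIC : ∀ s ∈ T, ∀ r ∈ T, u r + (s - r) * X r ≤ u s)
    (hK : ∀ᵐ s ∂μ, s ∈ T ∧ 0 ≤ K s ∧
      ∫⁻ q in Ioo 0 (X s), ENNReal.ofReal (quantile γ q) ≤ ENNReal.ofReal (K s)) :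
    ∫⁻ s, ENNReal.ofReal (s * X s - u s - K s) ∂μ ≤ ∫⁻ κ, itemProfit μ κ ∂γ := by
  set φ : ℝ → ℝ≥0∞ := fun q => lowestServed T X q - ENNReal.ofReal (quantile γ q) with hφ
  have hQ : AEMeasurable (fun q => ENNReal.ofReal (quantile γ q)) (volume.restrict (Ioo 0 1)) :=
    (aemeasurable_quantile γ).ennreal_ofReal
  have hφm : AEMeasurable φ (volume.restrict (Ioo 0 1)) :=
    (monotone_lowestServed T X).measurable.aemeasurable.sub hQ
  have hset : MeasurableSet {z : ℝ × ℝ | z.2 < X z.1} :=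
    measurableSet_lt measurable_snd (hX.comp measurable_fst)
  -- Payment and cost are compared level by level. The truncated difference `φ` is nonnegative, so
  -- positive parts are bounded too.
  have hpt : ∀ᵐ s ∂μ, ENNReal.ofReal (s * X s - u s - K s)
      ≤ ∫⁻ q in Ioo 0 1, {z : ℝ × ℝ | z.2 < X z.1}.indicator (fun z => φ z.2) (s, q) := by
    filter_upwards [hK] with s ⟨hs, hK0, hKs⟩
    have hsub : Ioo 0 (X s) ⊆ Ioo 0 1 := Ioo_subset_Ioo_right (hX1 s hs)
    calc ENNReal.ofReal (s * X s - u s - K s)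
        = ENNReal.ofReal (s * X s - u s) - ENNReal.ofReal (K s) := ENNReal.ofReal_sub _ hK0
      _ ≤ (∫⁻ q in Ioo 0 (X s), lowestServed T X q)
          - ∫⁻ q in Ioo 0 (X s), ENNReal.ofReal (quantile γ q) :=
        tsub_le_tsub (ofReal_payment_le_lintegral hT hX0 hu hIC hs) hKs
      _ ≤ ∫⁻ q in Ioo 0 (X s), φ q :=
        lintegral_sub_le' _ _ (hQ.mono_measure (Measure.restrict_mono hsub le_rfl))
      _ = ∫⁻ q in Ioo 0 1, (Iio (X s)).indicator φ q := by
        rw [setLIntegral_indicator measurableSet_Iio]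
        congr 2
        ext q
        simp only [mem_Ioo, mem_inter_iff, mem_Iio]
        exact ⟨fun h => ⟨h.2, h.1, (hsub h).2⟩, fun h => ⟨h.2.1, h.1⟩⟩
      _ = _ := rfl
  calc ∫⁻ s, ENNReal.ofReal (s * X s - u s - K s) ∂μ
      ≤ ∫⁻ s, (∫⁻ q in Ioo 0 1,
          {z : ℝ × ℝ | z.2 < X z.1}.indicator (fun z => φ z.2) (s, q)) ∂μ := lintegral_mono_ae hpt
    _ = ∫⁻ q in Ioo 0 1, ∫⁻ s,
          {z : ℝ × ℝ | z.2 < X z.1}.indicator (fun z => φ z.2) (s, q) ∂μ := by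
        refine lintegral_lintegral_swap ?_
        exact (hφm.comp_quasiMeasurePreserving Measure.quasiMeasurePreserving_snd).indicator hset
    -- After the swap, each level `q` is a posted price offered to all of `μ`, at the fixed cost
    -- `quantile γ q`.
    _ ≤ ∫⁻ q in Ioo 0 1, itemProfit μ (quantile γ q) := by
        refine lintegral_mono fun q => ?_
        have hq : MeasurableSet {s | q < X s} := measurableSet_lt measurable_const hX
        calc ∫⁻ s, {z : ℝ × ℝ | z.2 < X z.1}.indicator (fun z => φ z.2) (s, q) ∂μ
            = ∫⁻ s, {s | q < X s}.indicator (fun _ => φ q) s ∂μ := rfl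
          _ = φ q * μ {s | q < X s} := lintegral_indicator_const hq _
          _ = φ q * μ {s | s ∈ T ∧ q < X s} := by
              congr 1
              refine measure_congr ?_
              filter_upwards [hK] with s hs
              exact propext ⟨fun h => ⟨hs.1, h⟩, fun h => h.2⟩
          _ ≤ _ := lowestServed_mul_le_itemProfit μ X (quantile_nonneg γ q) q
    _ = ∫⁻ κ, itemProfit μ κ ∂γ := by
        rw [← lintegral_map' (measurable_itemProfit μ).aemeasurable (aemeasurable_quantile γ),
          map_quantile γ hγ]

/-! ### A lower bound on the profit of item posted pricing -/

lemma sum_filter_nonneg_eq_sum_max {ι : Type*} (P : Finset ι) (a : ι → ℝ) :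
    ∑ j ∈ P with 0 ≤ a j, a j = ∑ j ∈ P, max (a j) 0 := by
  rw [Finset.sum_filter]
  refine Finset.sum_congr rfl fun j _ => ?_
  split_ifs with h
  · rw [max_eq_left h]
  · rw [max_eq_right (not_le.1 h).le]

lemma sum_le_sum_filter_nonneg {ι : Type*} {S P : Finset ι} (h : S ⊆ P) (a : ι → ℝ) :
    ∑ j ∈ S, a j ≤ ∑ j ∈ P with 0 ≤ a j, a j := by
  rw [sum_filter_nonneg_eq_sum_max]
  exact (Finset.sum_le_sum fun j _ => le_max_left _ _).trans
    (Finset.sum_le_sum_of_subset_of_nonneg h fun j _ _ => le_max_right _ _)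

lemma isFavorite_filter {m : ℕ} (P : Finset (Fin m)) (t q : Fin m → ℝ) :
    IsFavorite P.powerset (bundleUtility t q) {j ∈ P | q j ≤ t j} := by
  refine ⟨Finset.mem_powerset.2 (Finset.filter_subset _ _), fun S hS => ?_⟩
  have := sum_le_sum_filter_nonneg (Finset.mem_powerset.1 hS) fun j => t j - q j
  simpa only [bundleUtility, sub_nonneg] using this

instance {m : ℕ} (D : Fin m → Measure ℝ) [∀ j, IsProbabilityMeasure (D j)] :
    IsProbabilityMeasure (typeLaw D) := by
  unfold typeLaw; infer_instance

lemma typeLaw_preimage_eval {m : ℕ} (D : Fin m → Measure ℝ) [∀ j, IsProbabilityMeasure (D j)]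
    (j : Fin m) {s : Set ℝ} (hs : MeasurableSet s) : typeLaw D {t | t j ∈ s} = D j s :=
  (measurePreserving_eval D j).measure_preimage hs.nullMeasurableSet

/-- The posted pricing that sells item `j` at the price `π j (c j)`. -/
noncomputable def separatePricing {m : ℕ} (π : Fin m → ℝ → ℝ) (hπ : ∀ j, Measurable (π j)) :
    ItemPricing m where
  price c j := π j (c j)
  bundle t c := {j | π j (c j) ≤ t j}
  bundle_favorite t c := by
    simpa using isFavorite_filter Finset.univ t fun j => π j (c j)
  measurable_price := measurable_pi_lambda _ fun j => (hπ j).comp (measurable_pi_apply j)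
  measurable_bundle j := by
    simp only [Finset.mem_filter, Finset.mem_univ, true_and]
    exact measurableSet_le ((hπ j).comp ((measurable_pi_apply j).comp measurable_snd))
      ((measurable_pi_apply j).comp measurable_fst)

lemma coe_ennreal_lintegral_ofReal {α : Type*} [MeasurableSpace α] {μ : Measure α} {f : α → ℝ}
    (hf : Integrable f μ) (h0 : ∀ z, 0 ≤ f z) :
    ((∫⁻ z, ENNReal.ofReal (f z) ∂μ : ℝ≥0∞) : EReal) = ((∫ z, f z ∂μ : ℝ) : EReal) := by
  rw [← ofReal_integral_eq_lintegral_ofReal hf (Eventually.of_forall h0),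
    EReal.coe_ennreal_ofReal, max_eq_left (integral_nonneg h0)]

/-- The markup bound `B` makes the profit integrable, which `ipProfit` demands of its competitors.
-/
lemma sum_lintegral_separatePricing_le {m : ℕ} (D : Fin m → Measure ℝ) (C : Measure (Fin m → ℝ))
    [∀ j, IsProbabilityMeasure (D j)] [IsProbabilityMeasure C] (hC : ∀ᵐ c ∂C, ∀ j, 0 ≤ c j)
    {π : Fin m → ℝ → ℝ} (hπ : ∀ j, Measurable (π j)) (hπ0 : ∀ j κ, κ ≤ π j κ) {B : ℝ}
    (hπB : ∀ j κ, 0 ≤ κ → π j κ - κ ≤ B) :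
    ((∑ j, ∫⁻ c, ENNReal.ofReal (π j (c j) - c j) * D j (Ici (π j (c j))) ∂C : ℝ≥0∞) : EReal)
      ≤ ipProfit D C := by
  set M := separatePricing π hπ with hM
  have hprof : ∀ t c, M.profitAt t c
      = ∑ j, {z : (Fin m → ℝ) × (Fin m → ℝ) | π j (z.2 j) ≤ z.1 j}.indicator
          (fun z => π j (z.2 j) - z.2 j) (t, c) := by
    intro t c
    simp only [ItemPricing.profitAt, hM, separatePricing, Finset.sum_filter, indicator,
      mem_ofPred_eq]
  have hc : ∀ j, Measurable fun z : (Fin m → ℝ) × (Fin m → ℝ) => z.2 j := fun j =>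
    (measurable_pi_apply j).comp measurable_snd
  have hset : ∀ j, MeasurableSet {z : (Fin m → ℝ) × (Fin m → ℝ) | π j (z.2 j) ≤ z.1 j} :=
    fun j => measurableSet_le ((hπ j).comp (hc j)) ((measurable_pi_apply j).comp measurable_fst)
  have hdiff : ∀ j, Measurable fun z : (Fin m → ℝ) × (Fin m → ℝ) => π j (z.2 j) - z.2 j :=
    fun j => ((hπ j).comp (hc j)).sub (hc j)
  have hterm : ∀ j, Integrable ({z : (Fin m → ℝ) × (Fin m → ℝ) | π j (z.2 j) ≤ z.1 j}.indicator
      (fun z => π j (z.2 j) - z.2 j)) ((typeLaw D).prod C) := by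
    intro j
    refine Integrable.indicator ?_ (hset j)
    refine Integrable.of_bound (hdiff j).aestronglyMeasurable B ?_
    have : ∀ᵐ z ∂(typeLaw D).prod C, ∀ j, 0 ≤ z.2 j :=
      Measure.quasiMeasurePreserving_snd.ae hC
    filter_upwards [this] with z hz
    rw [Real.norm_eq_abs, abs_of_nonneg (sub_nonneg.2 (hπ0 j _))]
    exact hπB j _ (hz j)
  have hnn : ∀ j z, 0 ≤ {z : (Fin m → ℝ) × (Fin m → ℝ) | π j (z.2 j) ≤ z.1 j}.indicator
      (fun z => π j (z.2 j) - z.2 j) z := fun j z =>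
    indicator_nonneg (fun z _ => sub_nonneg.2 (hπ0 j _)) z
  have hint : Integrable (fun z : (Fin m → ℝ) × (Fin m → ℝ) => M.profitAt z.1 z.2)
      ((typeLaw D).prod C) := by
    simp only [hprof]
    exact integrable_finsetSum _ fun j _ => hterm j
  have h0 : ∀ z : (Fin m → ℝ) × (Fin m → ℝ), 0 ≤ M.profitAt z.1 z.2 := by
    intro z
    rw [hprof]
    exact Finset.sum_nonneg fun j _ => hnn j _
  refine le_trans (le_of_eq ?_) (le_iSup₂_of_le M hint le_rfl)
  rw [← coe_ennreal_lintegral_ofReal hint h0]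
  congr 1
  simp only [hprof]
  simp_rw [ENNReal.ofReal_sum_of_nonneg fun j _ => hnn j _]
  rw [lintegral_finsetSum _ fun j _ => ((hdiff j).indicator (hset j)).ennreal_ofReal]
  refine Finset.sum_congr rfl fun j _ => ?_
  rw [lintegral_prod_symm' _ ((hdiff j).indicator (hset j)).ennreal_ofReal]
  refine lintegral_congr fun c => ?_
  rw [← typeLaw_preimage_eval D j measurableSet_Ici, ← lintegral_indicator_const]
  · refine lintegral_congr fun t => ?_
    simp only [indicator, mem_ofPred_eq, mem_Ici]
    split_ifs <;> simp
  · exact measurableSet_le measurable_const (measurable_pi_apply j)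

/-- The best among the first `n` prices of the list `e`, and the price `κ`, for selling an item with
value distribution `μ` at cost `κ`. -/
noncomputable def bestPrice (μ : Measure ℝ) (e : ℕ → ℝ) : ℕ → ℝ → ℝ
  | 0, κ => κ
  | n + 1, κ =>
    if (bestPrice μ e n κ - κ) * μ.real (Ici (bestPrice μ e n κ)) < (e n - κ) * μ.real (Ici (e n))
    then e n else bestPrice μ e n κ

section BestPrice

variable (μ : Measure ℝ) (e : ℕ → ℝ)

lemma measurable_bestPrice [IsFiniteMeasure μ] (n : ℕ) : Measurable (bestPrice μ e n) := by
  have hanti : Measurable fun p => μ.real (Ici p) :=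
    Antitone.measurable fun p q h => measureReal_mono (Ici_subset_Ici.2 h)
  induction n with
  | zero => exact measurable_id
  | succ n ih =>
    exact Measurable.ite (measurableSet_lt ((ih.sub measurable_id).mul (hanti.comp ih))
      ((measurable_const.sub measurable_id).mul measurable_const)) measurable_const ih

/-- A price below cost earns at most `0`, so it never strictly beats the nonnegative profit already
secured. -/
lemma le_bestPrice (n : ℕ) (κ : ℝ) : κ ≤ bestPrice μ e n κ := by
  induction n with
  | zero => exact le_rfl
  | succ n ih =>
    rw [bestPrice]
    split_ifs with h
    · by_contra hlt
      have h1 : (e n - κ) * μ.real (Ici (e n)) ≤ 0 :=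
        mul_nonpos_of_nonpos_of_nonneg (by linarith) measureReal_nonneg
      have h2 : 0 ≤ (bestPrice μ e n κ - κ) * μ.real (Ici (bestPrice μ e n κ)) :=
        mul_nonneg (sub_nonneg.2 ih) measureReal_nonneg
      linarith
    · exact ih

lemma bestPrice_sub_le (n : ℕ) {κ : ℝ} (hκ : 0 ≤ κ) :
    bestPrice μ e n κ - κ ≤ ∑ i ∈ Finset.range n, |e i| := by
  induction n with
  | zero => simp [bestPrice]
  | succ n ih =>
    have hs : 0 ≤ ∑ i ∈ Finset.range n, |e i| := Finset.sum_nonneg fun _ _ => abs_nonneg _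
    rw [bestPrice, Finset.sum_range_succ]
    split_ifs with h
    · linarith [le_abs_self (e n)]
    · linarith [abs_nonneg (e n)]

lemma monotone_bestPrice_profit (κ : ℝ) :
    Monotone fun n => (bestPrice μ e n κ - κ) * μ.real (Ici (bestPrice μ e n κ)) := by
  refine monotone_nat_of_le_succ fun n => ?_
  rw [bestPrice]
  split_ifs with h
  · exact h.le
  · exact le_rfl

lemma le_bestPrice_profit (n : ℕ) (κ : ℝ) : (e n - κ) * μ.real (Ici (e n))
    ≤ (bestPrice μ e (n + 1) κ - κ) * μ.real (Ici (bestPrice μ e (n + 1) κ)) := by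
  rw [bestPrice]
  split_ifs with h
  · exact le_rfl
  · exact not_lt.1 h

end BestPrice

/-- The optimal price need not exist or give an integrable profit. The best of finitely many
rational prices has a bounded markup and increasing profit, so monotone convergence reaches the
supremum. -/
lemma sum_lintegral_itemProfit_le_ipProfit {m : ℕ} (D : Fin m → Measure ℝ)
    (C : Measure (Fin m → ℝ)) [∀ j, IsProbabilityMeasure (D j)] [IsProbabilityMeasure C]
    (hC : ∀ᵐ c ∂C, ∀ j, 0 ≤ c j) :
    ((∑ j, ∫⁻ c, itemProfit (D j) (c j) ∂C : ℝ≥0∞) : EReal) ≤ ipProfit D C := by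
  obtain ⟨e, he⟩ := exists_surjective_nat ℚ
  set e' : ℕ → ℝ := fun n => e n with he'
  set h : Fin m → ℕ → (Fin m → ℝ) → ℝ≥0∞ := fun j n c =>
    ENNReal.ofReal (bestPrice (D j) e' n (c j) - c j) * D j (Ici (bestPrice (D j) e' n (c j)))
    with hh
  have hofReal : ∀ j p κ, ENNReal.ofReal (p - κ) * D j (Ici p)
      = ENNReal.ofReal ((p - κ) * (D j).real (Ici p)) := by
    intro j p κ
    rw [ENNReal.ofReal_mul' measureReal_nonneg, ofReal_measureReal]
  have hn : ∀ n, ((∑ j, ∫⁻ c, h j n c ∂C : ℝ≥0∞) : EReal) ≤ ipProfit D C := fun n =>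
    sum_lintegral_separatePricing_le D C hC (fun j => measurable_bestPrice (D j) e' n)
      (fun j κ => le_bestPrice (D j) e' n κ) fun j κ hκ => bestPrice_sub_le (D j) e' n hκ
  have hmono : ∀ j, Monotone (h j) := fun j n k hnk c => by
    simp only [hh, hofReal]
    exact ENNReal.ofReal_le_ofReal (monotone_bestPrice_profit (D j) e' (c j) hnk)
  have hmeas : ∀ j n, Measurable (h j n) := fun j n => by
    simp only [hh, hofReal]
    have hanti : Measurable fun p => (D j).real (Ici p) :=
      Antitone.measurable fun p q h => measureReal_mono (Ici_subset_Ici.2 h)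
    have hb := (measurable_bestPrice (D j) e' n).comp (measurable_pi_apply (X := fun _ => ℝ) j)
    exact ((hb.sub (measurable_pi_apply j)).mul (hanti.comp hb)).ennreal_ofReal
  have h0 : 0 ≤ ipProfit D C := by simpa [hh, bestPrice] using hn 0
  rw [← EReal.coe_toENNReal h0, EReal.coe_ennreal_le_coe_ennreal_iff]
  calc ∑ j, ∫⁻ c, itemProfit (D j) (c j) ∂C
      ≤ ∑ j, ∫⁻ c, ⨆ n, h j n c ∂C := by
        refine Finset.sum_le_sum fun j _ => lintegral_mono fun c => iSup_le fun p => ?_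
        obtain ⟨n, rfl⟩ := he p
        -- The price `e n` first competes at stage `n + 1`.
        refine le_iSup_of_le (n + 1) ?_
        simp only [hh]
        rw [hofReal, hofReal]
        exact ENNReal.ofReal_le_ofReal (le_bestPrice_profit (D j) e' n (c j))
    _ = ∑ j, ⨆ n, ∫⁻ c, h j n c ∂C :=
        Finset.sum_congr rfl fun j _ => lintegral_iSup (hmeas j) (hmono j)
    _ = ⨆ n, ∑ j, ∫⁻ c, h j n c ∂C :=
        ENNReal.finsetSum_iSup_of_monotone fun j n k hnk => lintegral_mono (hmono j hnk)
    _ ≤ (ipProfit D C).toENNReal := by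
        refine iSup_le fun n => ?_
        rw [← EReal.coe_ennreal_le_coe_ennreal_iff, EReal.coe_toENNReal h0]
        exact hn n

/-! ### Lower bounds on the profits of permit selling -/

section Permits

variable {m : ℕ} {C : Measure (Fin m → ℝ)}

/-- The value of the permit for item `j` to a buyer who values the item at `s`. -/
noncomputable def itemPermitValue (C : Measure (Fin m → ℝ)) (j : Fin m) (s : ℝ) : ℝ :=
  ∫ c, max (s - c j) 0 ∂C

lemma itemPermitValue_nonneg (j : Fin m) (s : ℝ) : 0 ≤ itemPermitValue C j s :=
  integral_nonneg fun _ => le_max_right _ _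

lemma integrable_max_sub_cost [IsProbabilityMeasure C] (hC : ∀ᵐ c ∂C, ∀ j, 0 ≤ c j)
    (j : Fin m) (s : ℝ) : Integrable (fun c : Fin m → ℝ => max (s - c j) 0) C := by
  refine Integrable.of_bound
    ((measurable_const.sub (measurable_pi_apply j)).max measurable_const).aestronglyMeasurable |s| ?_
  filter_upwards [hC] with c hc
  rw [Real.norm_eq_abs, abs_of_nonneg (le_max_right _ _)]
  exact max_le (by linarith [hc j, le_abs_self s]) (abs_nonneg s)

lemma measurable_itemPermitValue [IsProbabilityMeasure C] (hC : ∀ᵐ c ∂C, ∀ j, 0 ≤ c j)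
    (j : Fin m) : Measurable (itemPermitValue C j) := by
  refine Monotone.measurable fun s r h => ?_
  exact integral_mono (integrable_max_sub_cost hC j s) (integrable_max_sub_cost hC j r)
    fun c => max_le_max (sub_le_sub_right h _) le_rfl

/-- The second-stage choice separates over the items: she takes an item exactly when its cost does
not exceed its value. Permit values are therefore additive. -/
lemma permitValue_eq_sum [IsProbabilityMeasure C] (hC : ∀ᵐ c ∂C, ∀ j, 0 ≤ c j)
    (t : Fin m → ℝ) (P : Finset (Fin m)) :
    permitValue C t P = ∑ j ∈ P, itemPermitValue C j (t j) := by
  unfold itemPermitValue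
  rw [← integral_finsetSum _ fun j _ => integrable_max_sub_cost hC j (t j)]
  refine integral_congr_ae (Eventually.of_forall fun c => ?_)
  simp only
  obtain ⟨hmem, hmax⟩ := isFavorite_filter P t c
  have hval : bundleUtility t c {j ∈ P | c j ≤ t j} = ∑ j ∈ P, max (t j - c j) 0 := by
    rw [← sum_filter_nonneg_eq_sum_max]
    simp only [bundleUtility, sub_nonneg]
  rw [← hval]
  exact le_antisymm (Finset.sup'_le _ _ hmax) (Finset.le_sup' _ hmem)

lemma measurableSet_mem_filter_le {permits : (Fin m → ℝ) → Finset (Fin m)} {j : Fin m}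
    (h : MeasurableSet {t | j ∈ permits t}) :
    MeasurableSet {z : (Fin m → ℝ) × (Fin m → ℝ) |
      j ∈ (permits z.1).filter fun i => z.2 i ≤ z.1 i} := by
  have : {z : (Fin m → ℝ) × (Fin m → ℝ) |
        j ∈ (permits z.1).filter fun i => z.2 i ≤ z.1 i}
      = Prod.fst ⁻¹' {t | j ∈ permits t} ∩
          {z : (Fin m → ℝ) × (Fin m → ℝ) | z.2 j ≤ z.1 j} := by
    ext z
    simp
  rw [this]
  exact (measurable_fst h).inter (measurableSet_le ((measurable_pi_apply j).comp measurable_snd)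
    ((measurable_pi_apply j).comp measurable_fst))

/-- The permit-selling mechanism with given choices of permits; in the second stage the buyer takes
all the items that she can buy without a loss. -/
noncomputable def permitSelling {menu : Finset (Finset (Fin m))}
    {permitPrice : Finset (Fin m) → ℝ} (permits : (Fin m → ℝ) → Finset (Fin m))
    (hfav : ∀ t, IsFavorite menu (fun P => permitValue C t P - permitPrice P) (permits t))
    (hmeas : ∀ j, MeasurableSet {t | j ∈ permits t}) : PermitSelling C menu permitPrice where
  permits := permits
  bundle t c := {j ∈ permits t | c j ≤ t j}
  permits_favorite := hfav
  bundle_favorite t c := isFavorite_filter (permits t) t c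
  measurable_permits := hmeas
  measurable_bundle j := measurableSet_mem_filter_le (hmeas j)

/-- Second-stage margins vanish, so profit is permit revenue. The menu is finite, hence the revenue
is bounded and integrable. -/
lemma coe_lintegral_permitSelling [IsProbabilityMeasure C] (D : Fin m → Measure ℝ)
    [∀ j, IsProbabilityMeasure (D j)] {menu : Finset (Finset (Fin m))}
    {permitPrice : Finset (Fin m) → ℝ} (M : PermitSelling C menu permitPrice)
    (h0 : ∀ P ∈ menu, 0 ≤ permitPrice P)
    (hm : Measurable fun t => permitPrice (M.permits t)) :
    ((∫⁻ t, ENNReal.ofReal (permitPrice (M.permits t)) ∂typeLaw D : ℝ≥0∞) : EReal)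
      = (M.profit D : EReal) := by
  have hnn : ∀ t, 0 ≤ permitPrice (M.permits t) := fun t => h0 _ (M.permits_favorite t).1
  have hint : Integrable (fun t => permitPrice (M.permits t)) (typeLaw D) := by
    refine Integrable.of_bound hm.aestronglyMeasurable (∑ P ∈ menu, permitPrice P)
      (Eventually.of_forall fun t => ?_)
    rw [Real.norm_eq_abs, abs_of_nonneg (hnn t)]
    exact Finset.single_le_sum (f := permitPrice) (fun P hP => h0 P hP) (M.permits_favorite t).1
  rw [coe_ennreal_lintegral_ofReal hint hnn]
  congr 1
  unfold PermitSelling.profit PermitSelling.profitAt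
  simp only [sub_self, Finset.sum_const_zero, add_zero]
  rw [integral_fun_fst (fun t => permitPrice (M.permits t))]
  simp

/-- By additivity she decides on each permit separately; ties are broken in favour of buying. -/
lemma sum_mul_le_ppProfit [IsProbabilityMeasure C] (D : Fin m → Measure ℝ)
    [∀ j, IsProbabilityMeasure (D j)] (hC : ∀ᵐ c ∂C, ∀ j, 0 ≤ c j) {l : Fin m → ℝ}
    (hl : ∀ j, 0 ≤ l j) :
    ((∑ j, ENNReal.ofReal (l j) * D j {s | l j ≤ itemPermitValue C j s} : ℝ≥0∞) : EReal)
      ≤ ppProfit D C := by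
  have hset : ∀ j, MeasurableSet {s | l j ≤ itemPermitValue C j s} := fun j =>
    measurableSet_le measurable_const (measurable_itemPermitValue hC j)
  have hset' : ∀ j, MeasurableSet {t : Fin m → ℝ | l j ≤ itemPermitValue C j (t j)} :=
    fun j => measurableSet_le measurable_const
      ((measurable_itemPermitValue hC j).comp (measurable_pi_apply j))
  set permits : (Fin m → ℝ) → Finset (Fin m) := fun t => {j | l j ≤ itemPermitValue C j (t j)}
    with hpermits
  have hmeas : ∀ j, MeasurableSet {t | j ∈ permits t} := fun j => by
    simpa [hpermits] using hset' j
  have hfav : ∀ t, IsFavorite Finset.univ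
      (fun P => permitValue C t P - ∑ j ∈ P, l j) (permits t) := by
    intro t
    refine ⟨Finset.mem_univ _, fun P _ => ?_⟩
    simp only [permitValue_eq_sum hC, ← Finset.sum_sub_distrib]
    have := sum_le_sum_filter_nonneg (Finset.subset_univ P)
      fun j => itemPermitValue C j (t j) - l j
    simpa only [sub_nonneg] using this
  have hprice : ∀ t, ∑ j ∈ permits t, l j
      = ∑ j, {t : Fin m → ℝ | l j ≤ itemPermitValue C j (t j)}.indicator (fun _ => l j) t := by
    intro t
    simp only [hpermits, Finset.sum_filter, indicator, mem_ofPred_eq]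
  refine le_trans (le_of_eq ?_) (le_iSup₂_of_le l (permitSelling permits hfav hmeas) le_rfl)
  rw [← coe_lintegral_permitSelling]
  · congr 1
    simp only [permitSelling, hprice]
    have hnn : ∀ j t, 0 ≤ {t : Fin m → ℝ | l j ≤ itemPermitValue C j (t j)}.indicator
        (fun _ => l j) t := fun j t => indicator_nonneg (fun _ _ => hl j) t
    simp_rw [ENNReal.ofReal_sum_of_nonneg fun j _ => hnn j _]
    rw [lintegral_finsetSum _ fun j _ => (measurable_const.indicator (hset' j)).ennreal_ofReal]
    refine Finset.sum_congr rfl fun j _ => ?_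
    rw [← typeLaw_preimage_eval D j (hset j)]
    have : ∀ t, ENNReal.ofReal ({t : Fin m → ℝ | l j ≤ itemPermitValue C j (t j)}.indicator
        (fun _ => l j) t) = {t : Fin m → ℝ | l j ≤ itemPermitValue C j (t j)}.indicator
        (fun _ => ENNReal.ofReal (l j)) t := fun t => by
      simp only [indicator]
      split_ifs <;> simp
    simp_rw [this]
    rw [lintegral_indicator_const (hset' j)]
    rfl
  · exact fun P _ => Finset.sum_nonneg fun j _ => hl j
  · simp only [permitSelling, hprice]
    exact Finset.measurable_fun_sum _ fun j _ => measurable_const.indicator (hset' j)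

/-- The construction needs `0 < m`: without items the grand bundle is `∅`, whose price is `0`. -/
lemma mul_le_pbProfit [IsProbabilityMeasure C] (D : Fin m → Measure ℝ)
    [∀ j, IsProbabilityMeasure (D j)] (hC : ∀ᵐ c ∂C, ∀ j, 0 ≤ c j) (hm : 0 < m) {δ : ℝ}
    (hδ : 0 ≤ δ) :
    ((ENNReal.ofReal δ * typeLaw D {t | δ ≤ ∑ j, itemPermitValue C j (t j)} : ℝ≥0∞) : EReal)
      ≤ pbProfit D C := by
  have : Nonempty (Fin m) := ⟨⟨0, hm⟩⟩
  set A : Set (Fin m → ℝ) := {t | δ ≤ ∑ j, itemPermitValue C j (t j)} with hA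
  have hAm : MeasurableSet A := measurableSet_le measurable_const
    (Finset.measurable_fun_sum _ fun j _ =>
      (measurable_itemPermitValue hC j).comp (measurable_pi_apply j))
  classical
  set permits : (Fin m → ℝ) → Finset (Fin m) := fun t => if t ∈ A then Finset.univ else ∅
    with hpermits
  have hmeas : ∀ j, MeasurableSet {t | j ∈ permits t} := fun j => by
    convert hAm using 1
    ext t
    by_cases h : t ∈ A <;> simp [hpermits, h]
  have huniv : (Finset.univ : Finset (Fin m)) ≠ ∅ := Finset.univ_nonempty.ne_empty
  have hfav : ∀ t, IsFavorite {∅, Finset.univ}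
      (fun P => permitValue C t P - if P = ∅ then 0 else δ) (permits t) := by
    intro t
    refine ⟨by by_cases h : t ∈ A <;> simp [hpermits, h], fun P hP => ?_⟩
    have hP' : P = ∅ ∨ P = Finset.univ := by simpa using hP
    simp only [permitValue_eq_sum hC, hpermits]
    by_cases h : t ∈ A
    · have h' : δ ≤ ∑ j, itemPermitValue C j (t j) := h
      rcases hP' with rfl | rfl <;> simp [h, huniv, h']
    · have h' : ∑ j, itemPermitValue C j (t j) < δ := not_le.1 h
      rcases hP' with rfl | rfl <;> simp [h, huniv, h'.le]
  set M : PermitSelling C {∅, Finset.univ} (fun P => if P = ∅ then 0 else δ) :=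
    permitSelling permits hfav hmeas
  have hprice : (fun t => if M.permits t = ∅ then 0 else δ) = A.indicator (fun _ => δ) := by
    funext t
    have hMt : M.permits t = permits t := rfl
    rw [hMt]
    by_cases h : t ∈ A <;> simp [hpermits, h, huniv]
  have hM := coe_lintegral_permitSelling D M
    (fun P _ => by split_ifs; exacts [le_rfl, hδ])
    (by rw [hprice]; exact measurable_const.indicator hAm)
  refine le_trans (le_of_eq ?_) (le_iSup₂_of_le δ M le_rfl)
  rw [← hM]
  congr 1
  have : ∀ t, ENNReal.ofReal (if M.permits t = ∅ then 0 else δ)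
      = A.indicator (fun _ => ENNReal.ofReal δ) t := fun t => by
    rw [congrFun hprice t]
    simp only [indicator]
    split_ifs <;> simp
  simp_rw [this]
  rw [lintegral_indicator_const hAm]

lemma pbProfit_nonneg [IsProbabilityMeasure C] (D : Fin m → Measure ℝ)
    [∀ j, IsProbabilityMeasure (D j)] (hC : ∀ᵐ c ∂C, ∀ j, 0 ≤ c j) : 0 ≤ pbProfit D C := by
  have hfav : ∀ t, IsFavorite {∅, Finset.univ}
      (fun P => permitValue C t P - if P = ∅ then 0 else 0) Finset.univ := by
    refine fun t => ⟨by simp, fun P _ => ?_⟩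
    simp only [permitValue_eq_sum hC, ite_self, sub_zero]
    exact Finset.sum_le_sum_of_subset_of_nonneg (Finset.subset_univ P)
      fun j _ _ => itemPermitValue_nonneg j _
  refine le_iSup₂_of_le 0 (permitSelling (fun _ => Finset.univ) hfav fun j => by simp) ?_
  rw [← coe_lintegral_permitSelling]
  · exact EReal.coe_ennreal_nonneg _
  · simp
  · simp

end Permits

/-! ### The values other than the largest -/

section CoreTail

variable {m : ℕ} (D : Fin m → Measure ℝ)

lemma measurable_update_prod (j : Fin m) :
    Measurable fun z : (Fin m → ℝ) × ℝ => Function.update z.1 j z.2 :=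
  measurable_pi_lambda _ fun k => by
    by_cases h : k = j
    · subst h
      simpa using measurable_snd
    · simpa [Function.update_of_ne h, Function.comp_def] using
        (measurable_pi_apply (X := fun _ : Fin m => ℝ) k).comp (measurable_fst (β := ℝ))

/-- Resampling one coordinate does not change the law of the type. -/
lemma map_update_typeLaw [∀ j, IsProbabilityMeasure (D j)] (j : Fin m) :
    ((typeLaw D).prod (D j)).map (fun z => Function.update z.1 j z.2) = typeLaw D := by
  refine (Measure.pi_eq fun s hs => ?_).symm
  rw [Measure.map_apply (measurable_update_prod j) (MeasurableSet.univ_pi hs)]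
  have hpre : (fun z : (Fin m → ℝ) × ℝ => Function.update z.1 j z.2) ⁻¹' univ.pi s
      = (univ.pi (Function.update s j univ)) ×ˢ (s j) := by
    ext z
    simp only [mem_preimage, mem_univ_pi, mem_prod]
    constructor
    · intro h
      refine ⟨fun k => ?_, by simpa using h j⟩
      by_cases hk : k = j
      · subst hk; simp
      · simpa [Function.update_of_ne hk] using h k
    · rintro ⟨h1, h2⟩ k
      by_cases hk : k = j
      · subst hk; simpa using h2
      · simpa [Function.update_of_ne hk] using h1 k
  rw [hpre, Measure.prod_prod]
  unfold typeLaw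
  rw [Measure.pi_pi, ← Finset.mul_prod_erase _ _ (Finset.mem_univ j),
    ← Finset.mul_prod_erase _ (fun i => D i (s i)) (Finset.mem_univ j)]
  simp only [Function.update_self, measure_univ, one_mul]
  rw [mul_comm]
  congr 1
  refine Finset.prod_congr rfl fun k hk => ?_
  rw [Function.update_of_ne (Finset.ne_of_mem_erase hk)]

/-- The outer `t j` is integrated but ignored, so one value can vary with the others fixed without
splitting the product space. -/
lemma lintegral_typeLaw_eq [∀ j, IsProbabilityMeasure (D j)] (j : Fin m)
    {f : (Fin m → ℝ) → ℝ≥0∞} (hf : Measurable f) :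
    ∫⁻ t, f t ∂typeLaw D = ∫⁻ t, (∫⁻ s, f (Function.update t j s) ∂D j) ∂typeLaw D := by
  conv_lhs => rw [← map_update_typeLaw D j, lintegral_map hf (measurable_update_prod j)]
  exact lintegral_prod _ (hf.comp (measurable_update_prod j)).aemeasurable

lemma lintegral_typeLaw_eq_symm [∀ j, IsProbabilityMeasure (D j)] (j : Fin m)
    {f : (Fin m → ℝ) → ℝ≥0∞} (hf : Measurable f) :
    ∫⁻ t, f t ∂typeLaw D = ∫⁻ s, (∫⁻ t, f (Function.update t j s) ∂typeLaw D) ∂D j := by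
  conv_lhs => rw [← map_update_typeLaw D j, lintegral_map hf (measurable_update_prod j)]
  exact lintegral_prod_symm' _ (hf.comp (measurable_update_prod j))

variable {v : Fin m → ℝ → ℝ} {r : ℝ}

/-- The part of the `j`-th value that exceeds `r` while some other value is at least as large. -/
noncomputable def tailValue (v : Fin m → ℝ → ℝ) (r : ℝ) (j k : Fin m) (t : Fin m → ℝ) : ℝ≥0∞ :=
  {t : Fin m → ℝ | r < v j (t j) ∧ v j (t j) ≤ v k (t k)}.indicator
    (fun t => ENNReal.ofReal (v j (t j))) t

/-- The part of the `j`-th value that does not exceed `r`. -/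
noncomputable def coreValue (v : Fin m → ℝ → ℝ) (r : ℝ) (j : Fin m) (s : ℝ) : ℝ :=
  {s | v j s ≤ r}.indicator (v j) s

lemma measurable_tailValue (hv : ∀ j, Measurable (v j)) (j k : Fin m) :
    Measurable (tailValue v r j k) := by
  have h : ∀ i, Measurable fun t : Fin m → ℝ => v i (t i) := fun i =>
    (hv i).comp (measurable_pi_apply i)
  exact (h j).ennreal_ofReal.indicator
    ((measurableSet_lt measurable_const (h j)).inter (measurableSet_le (h j) (h k)))

lemma measurable_coreValue (hv : ∀ j, Measurable (v j)) (j : Fin m) : Measurable (coreValue v r j) :=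
  (hv j).indicator (measurableSet_le (hv j) measurable_const)

/-- By independence, at `v j s = y > r` the competitors contribute `y ∑_k P(v_k ≥ y)`, at most `r`
by `hr`. The remaining `r ∑_j P(v_j ≥ r)` is bounded by `hr` once more, at `y = r`. -/
lemma lintegral_tailValue_le [∀ j, IsProbabilityMeasure (D j)]
    (hv : ∀ j, Measurable (v j)) (hr0 : 0 ≤ r)
    (hr : ∀ y, 0 ≤ y → ∑ j, ENNReal.ofReal y * D j {s | y ≤ v j s} ≤ ENNReal.ofReal r) :
    ∫⁻ t, ∑ j, ∑ k ∈ Finset.univ.erase j, tailValue v r j k t ∂typeLaw D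
      ≤ ENNReal.ofReal r := by
  have hm : ∀ j k, Measurable (tailValue v r j k) := measurable_tailValue hv
  have hpair : ∀ j, ∀ k ∈ Finset.univ.erase j, ∫⁻ t, tailValue v r j k t ∂typeLaw D
      = ∫⁻ s, {s | r < v j s}.indicator
          (fun s => ENNReal.ofReal (v j s) * D k {x | v j s ≤ v k x}) s ∂D j := by
    intro j k hk
    have hkj : k ≠ j := Finset.ne_of_mem_erase hk
    rw [lintegral_typeLaw_eq_symm D j (hm j k)]
    refine lintegral_congr fun s => ?_
    simp only [tailValue, indicator, mem_ofPred_eq, Function.update_self,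
      Function.update_of_ne hkj]
    split_ifs with h
    · have hset : MeasurableSet {x | v j s ≤ v k x} := measurableSet_le measurable_const (hv k)
      have hset' : MeasurableSet {t : Fin m → ℝ | t k ∈ {x | v j s ≤ v k x}} :=
        measurable_pi_apply k hset
      rw [← typeLaw_preimage_eval D k hset, ← lintegral_indicator_const hset']
      refine lintegral_congr fun t => ?_
      simp [indicator, h]
    · simp [h]
  have hmeas : ∀ j k, Measurable fun s => {s | r < v j s}.indicator
      (fun s => ENNReal.ofReal (v j s) * D k {x | v j s ≤ v k x}) s := by
    intro j k
    have hanti : Measurable fun y : ℝ => D k {x | y ≤ v k x} :=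
      Antitone.measurable fun y z hyz => measure_mono fun x hx => hyz.trans hx
    exact ((hv j).ennreal_ofReal.mul (hanti.comp (hv j))).indicator
      (measurableSet_lt measurable_const (hv j))
  rw [lintegral_finsetSum _ fun j _ => Finset.measurable_fun_sum _ fun k _ => hm j k]
  calc ∑ j, ∫⁻ t, ∑ k ∈ Finset.univ.erase j, tailValue v r j k t ∂typeLaw D
      ≤ ∑ j, ENNReal.ofReal r * D j {s | r ≤ v j s} := by
        refine Finset.sum_le_sum fun j _ => ?_
        rw [lintegral_finsetSum _ fun k _ => hm j k, Finset.sum_congr rfl (hpair j),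
          ← lintegral_finsetSum _ fun k _ => hmeas j k]
        calc _ ≤ ∫⁻ s, {s | r < v j s}.indicator (fun _ => ENNReal.ofReal r) s ∂D j := by
              refine lintegral_mono fun s => ?_
              simp only [indicator, mem_ofPred_eq]
              split_ifs with h
              · refine le_trans ?_ (hr (v j s) (hr0.trans h.le))
                exact Finset.sum_le_sum_of_subset (Finset.erase_subset _ _)
              · simp
          _ = ENNReal.ofReal r * D j {s | r < v j s} :=
              lintegral_indicator_const (measurableSet_lt measurable_const (hv j)) _
          _ ≤ _ := mul_le_mul' le_rfl (measure_mono fun s hs => (show r < v j s from hs).le)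
    _ ≤ ENNReal.ofReal r := hr r hr0

lemma coreValue_nonneg (hv0 : ∀ j s, 0 ≤ v j s) (j : Fin m) (s : ℝ) : 0 ≤ coreValue v r j s :=
  indicator_nonneg (fun s _ => hv0 j s) s

lemma coreValue_le_self (hv0 : ∀ j s, 0 ≤ v j s) (j : Fin m) (s : ℝ) : coreValue v r j s ≤ v j s :=
  indicator_le_self' (fun s _ => hv0 j s) s

lemma coreValue_le (hr0 : 0 ≤ r) (j : Fin m) (s : ℝ) : coreValue v r j s ≤ r := by
  simp only [coreValue, indicator, mem_ofPred_eq]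
  split_ifs with h
  exacts [h, hr0]

/-- Layer cake with weight `2 y`: levels above `r` are empty, and below `r` the integrand `2 y ∑_j
P(v_j ≥ y)` is at most `2 r` by `hr`. -/
lemma sum_lintegral_sq_coreValue_le (hv : ∀ j, Measurable (v j))
    (hv0 : ∀ j s, 0 ≤ v j s) (hr0 : 0 ≤ r)
    (hr : ∀ y, 0 ≤ y → ∑ j, ENNReal.ofReal y * D j {s | y ≤ v j s} ≤ ENNReal.ofReal r) :
    ∑ j, ∫⁻ s, ENNReal.ofReal (coreValue v r j s ^ 2) ∂D j ≤ ENNReal.ofReal (2 * r ^ 2) := by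
  have hw0 := coreValue_nonneg (r := r) hv0
  have hlayer : ∀ j, ∫⁻ s, ENNReal.ofReal (coreValue v r j s ^ 2) ∂D j
      = ∫⁻ y in Ioi 0, D j {s | y ≤ coreValue v r j s} * ENNReal.ofReal (2 * y) := by
    intro j
    rw [← lintegral_comp_eq_lintegral_meas_le_mul (D j) (Eventually.of_forall (hw0 j))
      (measurable_coreValue hv j).aemeasurable (g := fun y => 2 * y)]
    · refine lintegral_congr fun s => ?_
      congr 1
      rw [intervalIntegral.integral_const_mul, integral_id]
      ring
    · exact fun t _ => (continuous_const.mul continuous_id).intervalIntegrable _ _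
    · filter_upwards [ae_restrict_mem measurableSet_Ioi] with y hy
      exact mul_nonneg zero_le_two (mem_Ioi.1 hy).le
  rw [Finset.sum_congr rfl fun j _ => hlayer j, ← lintegral_finsetSum]
  · calc _ ≤ ∫⁻ y in Ioi 0, (Iic r).indicator (fun _ => ENNReal.ofReal (2 * r)) y := by
          refine setLIntegral_mono' measurableSet_Ioi fun y hy => ?_
          have hy0 : 0 < y := hy
          simp only [indicator, mem_Iic]
          split_ifs with hyr
          · calc ∑ j, D j {s | y ≤ coreValue v r j s} * ENNReal.ofReal (2 * y)
                ≤ ∑ j, 2 * (ENNReal.ofReal y * D j {s | y ≤ v j s}) := by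
                  refine Finset.sum_le_sum fun j _ => ?_
                  rw [ENNReal.ofReal_mul zero_le_two, mul_comm, ENNReal.ofReal_ofNat, mul_assoc]
                  gcongr
                  exact coreValue_le_self hv0 j _
              _ ≤ 2 * ENNReal.ofReal r := by
                  rw [← Finset.mul_sum]
                  exact mul_le_mul' le_rfl (hr y hy0.le)
              _ = ENNReal.ofReal (2 * r) := by
                  rw [ENNReal.ofReal_mul zero_le_two, ENNReal.ofReal_ofNat]
          · refine le_of_eq (Finset.sum_eq_zero fun j _ => ?_)
            have : {s | y ≤ coreValue v r j s} = ∅ := by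
              ext s
              simp only [mem_ofPred_eq, mem_empty_iff_false, iff_false, not_le]
              exact (coreValue_le hr0 j s).trans_lt (not_le.1 hyr)
            rw [this, measure_empty, zero_mul]
      _ = ENNReal.ofReal (2 * r ^ 2) := by
          rw [lintegral_indicator_const measurableSet_Iic, Measure.restrict_apply measurableSet_Iic,
            Set.inter_comm, Ioi_inter_Iic, Real.volume_Ioc, ← ENNReal.ofReal_mul (by positivity)]
          congr 1
          ring
  · intro j _
    have hanti : Measurable fun y : ℝ => D j {s | y ≤ coreValue v r j s} :=
      Antitone.measurable fun y z hyz => measure_mono fun x hx => hyz.trans hx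
    exact hanti.mul (measurable_const.mul measurable_id).ennreal_ofReal

lemma lintegral_coreValue_le [∀ j, IsProbabilityMeasure (D j)]
    (hv : ∀ j, Measurable (v j))
    (hv0 : ∀ j s, 0 ≤ v j s) (hr0 : 0 ≤ r)
    (hr : ∀ y, 0 ≤ y → ∑ j, ENNReal.ofReal y * D j {s | y ≤ v j s} ≤ ENNReal.ofReal r)
    {B : ℝ≥0∞}
    (hB : ∀ δ, 0 ≤ δ → ENNReal.ofReal δ * typeLaw D {t | δ ≤ ∑ j, v j (t j)} ≤ B) :
    ∫⁻ t, ∑ j, ENNReal.ofReal (coreValue v r j (t j)) ∂typeLaw D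
      ≤ 2 * ENNReal.ofReal r + 2 * B := by
  have hw0 := coreValue_nonneg (r := r) hv0
  have hwr := coreValue_le (v := v) hr0
  have hwm := measurable_coreValue (r := r) hv
  -- For `r = 0` the core vanishes; Chebyshev's inequality below needs a positive deviation.
  rcases hr0.eq_or_lt with rfl | hr0'
  · have hzero : ∀ j s, coreValue v 0 j s = 0 := fun j s => le_antisymm (hwr j s) (hw0 j s)
    simp [hzero]
  have hL2 : ∀ j, MemLp (coreValue v r j) 2 (D j) := fun j =>
    MemLp.of_bound (hwm j).aestronglyMeasurable r (Eventually.of_forall fun s => by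
      rw [Real.norm_eq_abs, abs_of_nonneg (hw0 j s)]; exact hwr j s)
  set W : (Fin m → ℝ) → ℝ := ∑ j, fun t : Fin m → ℝ => coreValue v r j (t j) with hW
  have hWt : ∀ t, W t = ∑ j, coreValue v r j (t j) := fun t => by simp [hW]
  have hWm : Measurable W := by
    have : W = fun t => ∑ j, coreValue v r j (t j) := funext hWt
    rw [this]
    exact Finset.measurable_fun_sum _ fun j _ => (hwm j).comp (measurable_pi_apply j)
  have hWL2 : MemLp W 2 (typeLaw D) := memLp_finsetSum' _ fun j _ =>
    (hL2 j).comp_measurePreserving (measurePreserving_eval D j)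
  have hW0 : ∀ t, 0 ≤ W t := fun t => by
    rw [hWt]; exact Finset.sum_nonneg fun j _ => hw0 j _
  have hWint : Integrable W (typeLaw D) := hWL2.integrable one_le_two
  have hvar : variance W (typeLaw D) ≤ 2 * r ^ 2 := by
    have h1 : variance W (typeLaw D) = ∑ j, variance (coreValue v r j) (D j) :=
      variance_sum_pi hL2
    have h2 : ∀ j, Integrable (fun s => coreValue v r j s ^ 2) (D j) := fun j =>
      (hL2 j).integrable_sq
    have h3 : ENNReal.ofReal (∑ j, ∫ s, coreValue v r j s ^ 2 ∂D j)
        ≤ ENNReal.ofReal (2 * r ^ 2) := by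
      rw [ENNReal.ofReal_sum_of_nonneg fun j _ => integral_nonneg fun s => sq_nonneg _]
      refine le_trans (le_of_eq ?_) (sum_lintegral_sq_coreValue_le D hv hv0 hr0 hr)
      exact Finset.sum_congr rfl fun j _ =>
        ofReal_integral_eq_lintegral_ofReal (h2 j) (Eventually.of_forall fun s => sq_nonneg _)
    rw [h1]
    refine (Finset.sum_le_sum fun j _ =>
      variance_le_expectation_sq (hwm j).aestronglyMeasurable).trans ?_
    exact (ENNReal.ofReal_le_ofReal_iff (by positivity)).1 h3
  set μ₀ : ℝ := ∫ t, W t ∂typeLaw D with hμ₀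
  have hcore : ∫⁻ t, ∑ j, ENNReal.ofReal (coreValue v r j (t j)) ∂typeLaw D
      = ENNReal.ofReal μ₀ := by
    rw [hμ₀, ofReal_integral_eq_lintegral_ofReal hWint (Eventually.of_forall hW0)]
    refine lintegral_congr fun t => ?_
    rw [hWt, ENNReal.ofReal_sum_of_nonneg fun j _ => hw0 j _]
  rw [hcore]
  -- The deviation `2 r` turns Chebyshev's bound into `2 r² / (2 r)² = 1/2`, so the price `δ` is
  -- accepted at least half of the time.
  set δ := μ₀ - 2 * r with hδ
  have hsplit : ENNReal.ofReal μ₀ ≤ 2 * ENNReal.ofReal r + ENNReal.ofReal δ := by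
    have : μ₀ = 2 * r + δ := by rw [hδ]; ring
    rw [this]
    refine ENNReal.ofReal_add_le.trans (le_of_eq ?_)
    rw [ENNReal.ofReal_mul zero_le_two, ENNReal.ofReal_ofNat]
  refine hsplit.trans (add_le_add_right ?_ _)
  rcases le_or_gt δ 0 with hδ0 | hδ0
  · rw [ENNReal.ofReal_of_nonpos hδ0]
    exact zero_le
  have hcheb : typeLaw D {t | 2 * r ≤ |W t - μ₀|} ≤ 2⁻¹ := by
    refine (meas_ge_le_variance_div_sq hWL2 (by positivity : 0 < 2 * r)).trans ?_
    have : variance W (typeLaw D) / (2 * r) ^ 2 ≤ 2⁻¹ := by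
      rw [div_le_iff₀ (by positivity)]
      linarith
    refine (ENNReal.ofReal_le_ofReal this).trans (le_of_eq ?_)
    rw [ENNReal.ofReal_inv_of_pos two_pos, ENNReal.ofReal_ofNat]
  have hset : MeasurableSet {t | δ ≤ W t} := measurableSet_le measurable_const hWm
  have hhalf : 2⁻¹ ≤ typeLaw D {t | δ ≤ ∑ j, v j (t j)} := by
    have h1 : typeLaw D {t | δ ≤ W t}ᶜ ≤ 2⁻¹ := by
      refine (measure_mono fun t ht => ?_).trans hcheb
      have ht' : W t < δ := not_le.1 ht
      change 2 * r ≤ |W t - μ₀|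
      rw [abs_sub_comm]
      refine le_trans ?_ (le_abs_self _)
      linarith
    have h2 : (1 : ℝ≥0∞) ≤ typeLaw D {t | δ ≤ W t} + 2⁻¹ := by
      rw [← measure_univ (μ := typeLaw D), ← measure_add_measure_compl hset]
      exact add_le_add_right h1 _
    have h3 : (2⁻¹ : ℝ≥0∞) ≤ typeLaw D {t | δ ≤ W t} := by
      rw [← ENNReal.inv_two_add_inv_two] at h2
      exact (ENNReal.add_le_add_iff_right (by simp)).1 h2
    refine h3.trans (measure_mono fun t ht => ?_)
    refine le_trans (show δ ≤ W t from ht) ?_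
    rw [hWt]
    exact Finset.sum_le_sum fun j _ => coreValue_le_self hv0 j _
  calc ENNReal.ofReal δ = 2 * (ENNReal.ofReal δ * 2⁻¹) := by
        rw [mul_comm (ENNReal.ofReal δ), ← mul_assoc, ENNReal.mul_inv_cancel (by simp) (by simp),
          one_mul]
    _ ≤ 2 * B := mul_le_mul' le_rfl ((mul_le_mul' le_rfl hhalf).trans (hB δ hδ0.le))

/-- Apart from the largest one, all the values are covered by the tail and the core. -/
lemma sum_erase_le_tailValue_add_coreValue {t : Fin m → ℝ} {i : Fin m}
    (hi : ∀ j, v j (t j) ≤ v i (t i)) :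
    ∑ j ∈ Finset.univ.erase i, ENNReal.ofReal (v j (t j))
      ≤ ∑ j, ∑ k ∈ Finset.univ.erase j, tailValue v r j k t
        + ∑ j, ENNReal.ofReal (coreValue v r j (t j)) := by
  rw [← Finset.sum_add_distrib]
  refine le_trans (Finset.sum_le_sum fun j hj => ?_)
    (Finset.sum_le_sum_of_subset (Finset.erase_subset i _))
  rcases le_or_gt (v j (t j)) r with h | h
  · refine le_trans (le_of_eq ?_) le_add_self
    simp [coreValue, h]
  · refine le_trans ?_ le_self_add
    have hij : i ∈ Finset.univ.erase j :=
      Finset.mem_erase.2 ⟨(Finset.ne_of_mem_erase hj).symm, Finset.mem_univ _⟩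
    refine le_trans (le_of_eq ?_)
      (Finset.single_le_sum (f := fun k => tailValue v r j k t) (fun _ _ => zero_le) hij)
    simp [tailValue, h, hi j]

end CoreTail

/-! ### An upper bound on the profit of a direct mechanism -/

namespace DirectMechanism

variable {m : ℕ} (M : DirectMechanism m) (C : Measure (Fin m → ℝ))

/-- The probability, over the costs, that a buyer who reports `t` receives item `j`. -/
noncomputable def interimAlloc (j : Fin m) (t : Fin m → ℝ) : ℝ := ∫ c, M.alloc t c j ∂C

/-- The expected cost of item `j` when the buyer reports `t`. -/
noncomputable def interimCost (j : Fin m) (t : Fin m → ℝ) : ℝ := ∫ c, c j * M.alloc t c j ∂C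

/-- The profit that remains from a truthful buyer of type `t` if item `j` is the only item. -/
noncomputable def itemSurplus (j : Fin m) (t : Fin m → ℝ) : ℝ :=
  t j * M.interimAlloc C j t - M.interimUtility C t t - M.interimCost C j t

/-- The type `t` is in the type space and the expectations that enter the profit from it exist. -/
structure IsRegular (D : Fin m → Measure ℝ) (t : Fin m → ℝ) : Prop where
  mem : t ∈ typeSpace D
  integrable_cost : ∀ j, Integrable (fun c => c j * M.alloc t c j) C

variable {C}

lemma measurable_alloc_apply (j : Fin m) :
    Measurable fun z : (Fin m → ℝ) × (Fin m → ℝ) => M.alloc z.1 z.2 j :=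
  (measurable_pi_apply j).comp M.measurable_alloc

lemma measurable_alloc_right (t : Fin m → ℝ) (j : Fin m) : Measurable fun c => M.alloc t c j :=
  (M.measurable_alloc_apply j).comp measurable_prodMk_left

lemma measurable_cost_mul_alloc (j : Fin m) :
    Measurable fun z : (Fin m → ℝ) × (Fin m → ℝ) => z.2 j * M.alloc z.1 z.2 j :=
  ((measurable_pi_apply j).comp measurable_snd).mul (M.measurable_alloc_apply j)

lemma interimAlloc_nonneg (j : Fin m) (t : Fin m → ℝ) : 0 ≤ M.interimAlloc C j t :=
  integral_nonneg fun c => M.alloc_nonneg t c j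

variable [IsProbabilityMeasure C]

lemma integrable_alloc (t : Fin m → ℝ) (j : Fin m) : Integrable (fun c => M.alloc t c j) C :=
  Integrable.of_bound (M.measurable_alloc_right t j).aestronglyMeasurable 1
    (Eventually.of_forall fun c => by
      rw [Real.norm_eq_abs, abs_of_nonneg (M.alloc_nonneg t c j)]
      exact M.alloc_le_one t c j)

lemma interimAlloc_le_one (j : Fin m) (t : Fin m → ℝ) : M.interimAlloc C j t ≤ 1 :=
  (integral_mono (M.integrable_alloc t j) (integrable_const 1) fun c => M.alloc_le_one t c j).trans
    (by simp)

lemma measurable_interimAlloc (j : Fin m) : Measurable (M.interimAlloc C j) :=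
  (M.measurable_alloc_apply j).stronglyMeasurable.integral_prod_right'.measurable

lemma measurable_interimCost (j : Fin m) : Measurable (M.interimCost C j) :=
  (M.measurable_cost_mul_alloc j).stronglyMeasurable.integral_prod_right'.measurable

lemma measurable_itemSurplus (j : Fin m) : Measurable (M.itemSurplus C j) := by
  have hu : Measurable fun z : (Fin m → ℝ) × (Fin m → ℝ) =>
      (∑ j, z.1 j * M.alloc z.1 z.2 j) - M.pay z.1 z.2 :=
    (Finset.measurable_fun_sum _ fun j _ =>
      ((measurable_pi_apply j).comp measurable_fst).mul (M.measurable_alloc_apply j)).sub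
      M.measurable_pay
  have hU : Measurable fun t => M.interimUtility C t t :=
    hu.stronglyMeasurable.integral_prod_right'.measurable
  exact (((measurable_pi_apply j).mul (M.measurable_interimAlloc j)).sub hU).sub
    (M.measurable_interimCost j)

lemma interimUtility_eq {r : Fin m → ℝ} (hr : Integrable (fun c => M.pay r c) C)
    (t : Fin m → ℝ) :
    M.interimUtility C t r = ∑ j, t j * M.interimAlloc C j r - ∫ c, M.pay r c ∂C := by
  have h : ∀ j ∈ Finset.univ, Integrable (fun c => t j * M.alloc r c j) C := fun j _ =>
    (M.integrable_alloc r j).const_mul _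
  unfold interimUtility interimAlloc
  rw [integral_sub (integrable_finsetSum _ h) hr, integral_finsetSum _ h]
  simp only [integral_const_mul]

variable {D : Fin m → Measure ℝ}

lemma integral_profitAt_eq {t : Fin m → ℝ} (hpay : Integrable (fun c => M.pay t c) C)
    (ht : M.IsRegular C D t) :
    ∫ c, M.profitAt t c ∂C
      = ∑ j, (t j * M.interimAlloc C j t - M.interimCost C j t) - M.interimUtility C t t := by
  unfold profitAt
  rw [integral_sub hpay (integrable_finsetSum _ fun j _ => ht.integrable_cost j),
    integral_finsetSum _ fun j _ => ht.integrable_cost j, M.interimUtility_eq hpay,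
    Finset.sum_sub_distrib]
  unfold interimCost
  ring

/-- Pointwise in `c`, an allocation in `[0, 1]` extracts at most the positive part of `t j - c j`.
-/
lemma mul_interimAlloc_sub_interimCost_le (hC : ∀ᵐ c ∂C, ∀ j, 0 ≤ c j) {t : Fin m → ℝ}
    (ht : M.IsRegular C D t) (j : Fin m) :
    t j * M.interimAlloc C j t - M.interimCost C j t ≤ itemPermitValue C j (t j) := by
  unfold interimAlloc interimCost itemPermitValue
  rw [← integral_const_mul, ← integral_sub ((M.integrable_alloc t j).const_mul _)
    (ht.integrable_cost j)]
  refine integral_mono (((M.integrable_alloc t j).const_mul _).sub (ht.integrable_cost j))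
    (integrable_max_sub_cost hC j (t j)) fun c => ?_
  have h0 := M.alloc_nonneg t c j
  have h1 := M.alloc_le_one t c j
  have h2 := le_max_left (t j - c j) 0
  have h3 := le_max_right (t j - c j) 0
  simp only
  nlinarith [mul_nonneg h3 (sub_nonneg.2 h1), mul_nonneg h0 (sub_nonneg.2 h2)]

/-- The total cost is payment minus profit, both integrable in `c` for almost every `t`; being a sum
of nonnegative terms, it dominates each of them. -/
lemma ae_isRegular [∀ j, IsProbabilityMeasure (D j)] (hC : ∀ᵐ c ∂C, ∀ j, 0 ≤ c j)
    (hexp : M.HasExpectations D C) : ∀ᵐ t ∂typeLaw D, M.IsRegular C D t := by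
  have hsupp : ∀ᵐ t ∂typeLaw D, t ∈ typeSpace D := by
    refine ae_all_iff.2 fun j => ?_
    exact (measurePreserving_eval D j).quasiMeasurePreserving.ae Measure.support_mem_ae
  filter_upwards [hsupp, hexp.2.prod_right_ae] with t ht hprof
  refine ⟨ht, fun j => ?_⟩
  have hsum : Integrable (fun c => ∑ j, c j * M.alloc t c j) C := by
    refine ((hexp.1 t ht).sub hprof).congr (Eventually.of_forall fun c => ?_)
    simp [profitAt]
  refine hsum.mono'
    ((M.measurable_cost_mul_alloc j).comp measurable_prodMk_left).aestronglyMeasurable ?_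
  filter_upwards [hC] with c hc
  have hnn : ∀ i, 0 ≤ c i * M.alloc t c i := fun i => mul_nonneg (hc i) (M.alloc_nonneg t c i)
  rw [Real.norm_eq_abs, abs_of_nonneg (hnn j)]
  exact Finset.single_le_sum (f := fun i => c i * M.alloc t c i) (fun i _ => hnn i)
    (Finset.mem_univ j)

/-- The two types agree off `j`, so the terms of the other items cancel in the incentive constraint.
-/
lemma interimUtility_update_le (hexp : M.HasExpectations D C) (hbic : M.IsBIC D C)
    {t : Fin m → ℝ} (ht : t ∈ typeSpace D) (j : Fin m) {s r : ℝ} (hs : s ∈ (D j).support)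
    (hr : r ∈ (D j).support) :
    M.interimUtility C (Function.update t j r) (Function.update t j r)
        + (s - r) * M.interimAlloc C j (Function.update t j r)
      ≤ M.interimUtility C (Function.update t j s) (Function.update t j s) := by
  have hmem : ∀ x ∈ (D j).support, Function.update t j x ∈ typeSpace D := by
    intro x hx k
    by_cases hk : k = j
    · subst hk; simpa using hx
    · simpa [Function.update_of_ne hk] using ht k
  refine le_trans (le_of_eq ?_) (hbic _ (hmem s hs) _ (hmem r hr))
  have hpay := hexp.1 _ (hmem r hr)
  rw [M.interimUtility_eq hpay, M.interimUtility_eq hpay, ← sub_eq_zero]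
  have hsum : ∑ k, Function.update t j s k * M.interimAlloc C k (Function.update t j r)
      - ∑ k, Function.update t j r k * M.interimAlloc C k (Function.update t j r)
      = (s - r) * M.interimAlloc C j (Function.update t j r) := by
    rw [← Finset.sum_sub_distrib, Fintype.sum_eq_single j]
    · simp only [Function.update_self]; ring
    · intro k hk
      simp only [Function.update_of_ne hk]; ring
  linarith

lemma support_nonneg {μ : Measure ℝ} (hμ : ∀ᵐ v ∂μ, 0 ≤ v) : ∀ s ∈ μ.support, 0 ≤ s :=
  fun _ hs => Measure.support_subset_of_isClosed isClosed_Ici hμ hs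

/-- The part of the profit that is due to item `j` is at most the profit from posting an optimal
price for item `j`. -/
lemma lintegral_itemSurplus_le [∀ j, IsProbabilityMeasure (D j)]
    (hD : ∀ j, ∀ᵐ v ∂(D j), 0 ≤ v) (hC : ∀ᵐ c ∂C, ∀ j, 0 ≤ c j)
    (hexp : M.HasExpectations D C) (hbic : M.IsBIC D C) (hir : M.IsInterimIR D C) (j : Fin m) :
    ∫⁻ t, ENNReal.ofReal (M.itemSurplus C j t) ∂typeLaw D
      ≤ ∫⁻ c, itemProfit (D j) (c j) ∂C := by
  rw [lintegral_typeLaw_eq D j (M.measurable_itemSurplus j).ennreal_ofReal]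
  have hγp : IsProbabilityMeasure (C.map fun c => c j) :=
    Measure.isProbabilityMeasure_map (measurable_pi_apply j).aemeasurable
  have hCj : ∀ᵐ c ∂C, 0 ≤ c j := hC.mono fun c hc => hc j
  have hγ : ∀ᵐ κ ∂(C.map fun c => c j), 0 ≤ κ :=
    (ae_map_iff (measurable_pi_apply j).aemeasurable measurableSet_Ici).2 hCj
  have hreg := M.ae_isRegular hC hexp
  -- Resampling coordinate `j` preserves the law, so almost every replacement of `t j` is again
  -- regular.
  have hreg' : ∀ᵐ t ∂typeLaw D, ∀ᵐ s ∂D j, M.IsRegular C D (Function.update t j s) := by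
    refine Measure.ae_ae_of_ae_prod
      (p := fun z : (Fin m → ℝ) × ℝ => M.IsRegular C D (Function.update z.1 j z.2)) ?_
    refine ae_of_ae_map (measurable_update_prod j).aemeasurable ?_
    rwa [map_update_typeLaw]
  have hbound : ∀ᵐ t ∂typeLaw D,
      ∫⁻ s, ENNReal.ofReal (M.itemSurplus C j (Function.update t j s)) ∂D j
        ≤ ∫⁻ c, itemProfit (D j) (c j) ∂C := by
    filter_upwards [hreg, hreg'] with t ht ht'
    rw [← lintegral_map (measurable_itemProfit (D j)) (measurable_pi_apply j)]
    have hupd : Measurable fun s : ℝ => Function.update t j s :=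
      (measurable_update_prod j).comp measurable_prodMk_left
    have hmem : ∀ x ∈ (D j).support, Function.update t j x ∈ typeSpace D := by
      intro x hx k
      by_cases hk : k = j
      · subst hk; simpa using hx
      · simpa [Function.update_of_ne hk] using ht.mem k
    -- The incentive constraints are available on the whole support; only the cost bound is almost
    -- everywhere.
    have := lintegral_ofReal_profit_le (D j) (C.map fun c => c j) hγ (support_nonneg (hD j))
      (X := fun s => M.interimAlloc C j (Function.update t j s))
      (u := fun s => M.interimUtility C (Function.update t j s) (Function.update t j s))
      (K := fun s => M.interimCost C j (Function.update t j s))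
      ((M.measurable_interimAlloc j).comp hupd) (fun s _ => M.interimAlloc_nonneg j _)
      (fun s _ => M.interimAlloc_le_one j _) (fun s hs => hir _ (hmem s hs))
      (fun s hs r hr => M.interimUtility_update_le hexp hbic ht.mem j hs hr) ?_
    · simpa only [itemSurplus, Function.update_self] using this
    · filter_upwards [ht'] with s hs
      have hnn : ∀ᵐ c ∂C, 0 ≤ c j * M.alloc (Function.update t j s) c j :=
        hCj.mono fun c hc => mul_nonneg hc (M.alloc_nonneg _ c j)
      refine ⟨by simpa using hs.mem j, integral_nonneg_of_ae hnn, ?_⟩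
      unfold interimCost
      rw [ofReal_integral_eq_lintegral_ofReal (hs.integrable_cost j) hnn]
      exact lintegral_quantile_le C (measurable_pi_apply j) hCj (M.measurable_alloc_right _ j)
        (fun c => M.alloc_nonneg _ c j) fun c => M.alloc_le_one _ c j
  refine (lintegral_mono_ae hbound).trans ?_
  simp

/-- The utility is charged to the item of largest permit value. Its surplus is then bounded by the
sum of all positive parts, which avoids a measurable choice of that item. -/
lemma ofReal_integral_profitAt_le (hC : ∀ᵐ c ∂C, ∀ j, 0 ≤ c j)
    (hexp : M.HasExpectations D C) (hir : M.IsInterimIR D C) {t : Fin m → ℝ}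
    (ht : M.IsRegular C D t) (r : ℝ) :
    ENNReal.ofReal (∫ c, M.profitAt t c ∂C)
      ≤ (∑ j, ∑ k ∈ Finset.univ.erase j, tailValue (itemPermitValue C) r j k t
        + ∑ j, ENNReal.ofReal (coreValue (itemPermitValue C) r j (t j)))
        + ∑ j, ENNReal.ofReal (M.itemSurplus C j t) := by
  rw [M.integral_profitAt_eq (hexp.1 t ht.mem) ht]
  -- Without items there is no largest value, but the profit is minus the utility, hence not
  -- positive.
  rcases isEmpty_or_nonempty (Fin m) with hm | hm
  · have := hir t ht.mem
    rw [ENNReal.ofReal_of_nonpos (by simpa using this)]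
    exact zero_le
  obtain ⟨i, hi⟩ := Finite.exists_max fun j => itemPermitValue C j (t j)
  refine le_trans ?_ (add_le_add (sum_erase_le_tailValue_add_coreValue hi)
    (Finset.single_le_sum (f := fun j => ENNReal.ofReal (M.itemSurplus C j t))
      (fun _ _ => zero_le) (Finset.mem_univ i)))
  rw [← ENNReal.ofReal_sum_of_nonneg fun j _ => itemPermitValue_nonneg j _]
  refine le_trans (ENNReal.ofReal_le_ofReal ?_) ENNReal.ofReal_add_le
  rw [← Finset.sum_erase_add _ _ (Finset.mem_univ i)]
  have := Finset.sum_le_sum fun j (_ : j ∈ Finset.univ.erase i) =>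
    M.mul_interimAlloc_sub_interimCost_le hC ht j
  unfold itemSurplus
  linarith

lemma profit_le_lintegral [∀ j, IsProbabilityMeasure (D j)] (hexp : M.HasExpectations D C) :
    (M.profit D C : EReal)
      ≤ ((∫⁻ t, ENNReal.ofReal (∫ c, M.profitAt t c ∂C) ∂typeLaw D : ℝ≥0∞) : EReal) := by
  set A := ∫⁻ t, ENNReal.ofReal (∫ c, M.profitAt t c ∂C) ∂typeLaw D with hA
  by_cases htop : A = ⊤
  · simp [htop]
  have hle : M.profit D C ≤ A.toReal := by
    unfold profit
    rw [integral_prod _ hexp.2,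
      integral_eq_lintegral_pos_part_sub_lintegral_neg_part hexp.2.integral_prod_left]
    exact sub_le_self _ ENNReal.toReal_nonneg
  refine (EReal.coe_le_coe_iff.2 hle).trans (le_of_eq ?_)
  conv_rhs => rw [← ENNReal.ofReal_toReal htop]
  rw [EReal.coe_ennreal_ofReal, max_eq_left ENNReal.toReal_nonneg]

end DirectMechanism

/-! ### Assembling the bound -/

lemma ppProfit_nonneg {m : ℕ} (D : Fin m → Measure ℝ) (C : Measure (Fin m → ℝ))
    [∀ j, IsProbabilityMeasure (D j)] [IsProbabilityMeasure C]
    (hC : ∀ᵐ c ∂C, ∀ j, 0 ≤ c j) : 0 ≤ ppProfit D C :=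
  (EReal.coe_ennreal_nonneg _).trans (sum_mul_le_ppProfit D hC (l := 0) fun _ => le_rfl)

lemma ipProfit_nonneg {m : ℕ} (D : Fin m → Measure ℝ) (C : Measure (Fin m → ℝ))
    [∀ j, IsProbabilityMeasure (D j)] [IsProbabilityMeasure C]
    (hC : ∀ᵐ c ∂C, ∀ j, 0 ≤ c j) : 0 ≤ ipProfit D C :=
  (EReal.coe_ennreal_nonneg _).trans (sum_lintegral_itemProfit_le_ipProfit D C hC)

lemma optProfit_le {m : ℕ} (D : Fin m → Measure ℝ) (C : Measure (Fin m → ℝ))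
    [∀ j, IsProbabilityMeasure (D j)] [IsProbabilityMeasure C]
    (hD : ∀ j, ∀ᵐ v ∂(D j), 0 ≤ v) (hC : ∀ᵐ c ∂C, ∀ j, 0 ≤ c j) :
    optProfit D C ≤ (((ipProfit D C).toENNReal + 3 * (ppProfit D C).toENNReal
      + 2 * (pbProfit D C).toENNReal : ℝ≥0∞) : EReal) := by
  have hIP := EReal.coe_toENNReal (ipProfit_nonneg D C hC)
  have hPP := EReal.coe_toENNReal (ppProfit_nonneg D C hC)
  have hPB := EReal.coe_toENNReal (pbProfit_nonneg D hC)
  set I := (ipProfit D C).toENNReal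
  set R := (ppProfit D C).toENNReal
  set B := (pbProfit D C).toENNReal
  refine iSup₂_le fun M ⟨hexp, hbic, hir⟩ => (M.profit_le_lintegral hexp).trans ?_
  rw [EReal.coe_ennreal_le_coe_ennreal_iff]
  -- If `PP` is infinite the bound is trivial; otherwise `PP` is a real number and serves as the
  -- threshold between core and tail.
  by_cases hR : R = ⊤
  · simp [hR]
  set r := R.toReal with hr
  have hrR : ENNReal.ofReal r = R := ENNReal.ofReal_toReal hR
  have hr0 : 0 ≤ r := ENNReal.toReal_nonneg
  have hv := measurable_itemPermitValue hC
  have hv0 : ∀ j s, 0 ≤ itemPermitValue C j s := itemPermitValue_nonneg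
  -- Separate permits, all at the common price `y`.
  have hprice : ∀ y, 0 ≤ y → ∑ j, ENNReal.ofReal y * D j {s | y ≤ itemPermitValue C j s}
      ≤ ENNReal.ofReal r := by
    intro y hy
    rw [hrR, ← EReal.coe_ennreal_le_coe_ennreal_iff, hPP]
    exact sum_mul_le_ppProfit D hC (l := fun _ => y) fun _ => hy
  have hbundle : ∀ δ, 0 ≤ δ →
      ENNReal.ofReal δ * typeLaw D {t | δ ≤ ∑ j, itemPermitValue C j (t j)} ≤ B := by
    intro δ hδ
    rcases Nat.eq_zero_or_pos m with rfl | hm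
    · rcases hδ.eq_or_lt with rfl | hδ'
      · simp
      · simp [not_le.2 hδ']
    · rw [← EReal.coe_ennreal_le_coe_ennreal_iff, hPB]
      exact mul_le_pbProfit D hC hm hδ
  have htail := lintegral_tailValue_le D hv hr0 hprice
  have hcore := lintegral_coreValue_le D hv hv0 hr0 hprice hbundle
  have hitem : ∑ j, ∫⁻ t, ENNReal.ofReal (M.itemSurplus C j t) ∂typeLaw D ≤ I := by
    refine (Finset.sum_le_sum fun j _ =>
      M.lintegral_itemSurplus_le hD hC hexp hbic hir j).trans ?_
    rw [← EReal.coe_ennreal_le_coe_ennreal_iff, hIP]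
    exact sum_lintegral_itemProfit_le_ipProfit D C hC
  have hmtail : Measurable fun t => ∑ j, ∑ k ∈ Finset.univ.erase j,
      tailValue (itemPermitValue C) r j k t :=
    Finset.measurable_fun_sum _ fun j _ => Finset.measurable_fun_sum _ fun k _ =>
      measurable_tailValue hv j k
  calc ∫⁻ t, ENNReal.ofReal (∫ c, M.profitAt t c ∂C) ∂typeLaw D
      ≤ ∫⁻ t, ((∑ j, ∑ k ∈ Finset.univ.erase j, tailValue (itemPermitValue C) r j k t
        + ∑ j, ENNReal.ofReal (coreValue (itemPermitValue C) r j (t j)))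
        + ∑ j, ENNReal.ofReal (M.itemSurplus C j t)) ∂typeLaw D := by
        refine lintegral_mono_ae ?_
        filter_upwards [M.ae_isRegular hC hexp] with t ht
        exact M.ofReal_integral_profitAt_le hC hexp hir ht r
    _ ≤ (ENNReal.ofReal r + (2 * ENNReal.ofReal r + 2 * B)) + I := by
        rw [lintegral_add_right _ (Finset.measurable_fun_sum _ fun j _ =>
            (M.measurable_itemSurplus j).ennreal_ofReal), lintegral_add_left hmtail,
          lintegral_finsetSum _ fun j _ => (M.measurable_itemSurplus j).ennreal_ofReal]
        exact add_le_add (add_le_add htail hcore) hitem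
    _ = I + 3 * R + 2 * B := by
        rw [hrR]
        ring

end ProfitMax

theorem theorem2 (m : ℕ)
    (D : Fin m → MeasureTheory.Measure ℝ) (C : MeasureTheory.Measure (Fin m → ℝ))
    [∀ j, MeasureTheory.IsProbabilityMeasure (D j)] [MeasureTheory.IsProbabilityMeasure C]
    (hD : ∀ j, ∀ᵐ v ∂(D j), 0 ≤ v) (hC : ∀ᵐ c ∂C, ∀ j, 0 ≤ c j) :
    ProfitMax.optProfit D C
        ≤ ProfitMax.ipProfit D C + 3 * ProfitMax.ppProfit D C + 2 * ProfitMax.pbProfit D C ∧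
      ProfitMax.optProfit D C
        ≤ 6 * max (ProfitMax.ipProfit D C)
            (max (ProfitMax.ppProfit D C) (ProfitMax.pbProfit D C)) := by
  have hIP := EReal.coe_toENNReal (ProfitMax.ipProfit_nonneg D C hC)
  have hPP := EReal.coe_toENNReal (ProfitMax.ppProfit_nonneg D C hC)
  have hPB := EReal.coe_toENNReal (ProfitMax.pbProfit_nonneg D hC)
  have hle := ProfitMax.optProfit_le D C hD hC
  generalize (ProfitMax.ipProfit D C).toENNReal = I at *
  generalize (ProfitMax.ppProfit D C).toENNReal = R at *
  generalize (ProfitMax.pbProfit D C).toENNReal = B at *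
  rw [← hIP, ← hPP, ← hPB]
  refine ⟨hle.trans (le_of_eq (by push_cast; rfl)), hle.trans ?_⟩
  have hmax : (6 : EReal) * max (I : EReal) (max R B)
      = ((6 * max I (max R B) : ENNReal) : EReal) := by
    rw [EReal.coe_ennreal_mul, EReal.coe_ennreal_strictMono.monotone.map_max,
      EReal.coe_ennreal_strictMono.monotone.map_max]
    rfl
  rw [hmax, EReal.coe_ennreal_le_coe_ennreal_iff]
  calc I + 3 * R + 2 * B
      ≤ max I (max R B) + 3 * max I (max R B) + 2 * max I (max R B) := by
        gcongr <;> simp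
    _ = 6 * max I (max R B) := by ring
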